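/- Let $m\ge 1$, $n\ge 1$ and let $\mathbb G=(\mathbb R^m\times\mathbb R^n,\circ,\delta_r)$ be a homogeneous Lie group, i.e. a smooth group law with identity $0$ for which the dilations $\delta_r(x_1,x_2)=(rx_1,r^2x_2)$, $r>0$, are automorphisms. Suppose that its Lie algebra $\mathfrak g$, with center $\mathfrak z$, is of H-type with respect to an inner product $\langle\cdot,\cdot\rangle$: $[\mathfrak z^\perp,\mathfrak z^\perp]=\mathfrak z$, and for every $z\in\mathfrak z$ with $\langle z,z\rangle=1$ the map $J_z:\mathfrak z^\perp\to\mathfrak z^\perp$ defined by $\langle J_z(v),w\rangle=\langle z,[v,w]\rangle$ for all $w\in\mathfrak z^\perp$ is orthogonal. Let $X_1,\dots,X_m$ be an orthonormal basis of $\mathfrak z^\perp$, regarded as left-invariant vector fields. Write $x=\mathrm{Exp}(v(x)+z(x))$ with $v(x)\in\mathfrak z^\perp$ and $z(x)\in\mathfrak z$, and put $$d(x)=\left(\|v(x)\|^4+16\|z(x)\|^2\right)^{1/4},\qquad B_1(0)=\{x: d(x)<1\},\qquad Q=m+2n .$$ Let $0<\delta\le 2$ and $\alpha=Q-\delta$.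 Then there is a constant $C>0$, depending only on $\delta$, $d$ and the fields $X_j$, such that the following holds for every open set $O\subseteq B_1(0)$. For $\varepsilon>0$ let $\eta_\varepsilon\in C^\infty([0,\infty))$ be any function with $0\le\eta_\varepsilon\le1$, $\eta_\varepsilon(\rho)=0$ for $0\le\rho<\varepsilon$ and $\eta_\varepsilon(\rho)=1$ for $\rho\ge2\varepsilon$. The functions $$h(x)=-\frac1\alpha\int_O d(x^{-1}\circ\xi)^{-\alpha}\,d\xi,\qquad h_\varepsilon(x)=-\frac1\alpha\int_O\frac{\eta_\varepsilon(d(x^{-1}\circ\xi))}{d(x^{-1}\circ\xi)^{\alpha}}\,d\xi$$ are well defined on $\mathbb G$ (the integrals converge absolutely), $h_\varepsilon\in C^\infty(\mathbb G)$, and $h_\varepsilon\to h$ uniformly on $\mathbb G$ as $\varepsilon\to0^+$. Moreover, let $0<\lambda\le\Lambda$, let $\Omega\subseteq\mathbb G$ be open, and let $A=(a_{ij})$ be a function on $\Omega$ whose values are symmetric $m\times m$ matrices with $\lambda\|\zeta\|^2\le\langle A(x)\zeta,\zeta\rangle\le\Lambda\|\zeta\|^2$ for all $\zeta\in\mathbb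 R^m$, $x\in\Omega$, satisfying the $\delta$-Landis condition $$\mathrm{Tr}(A(x))+(Q+2-m)\max_{\|\zeta\|=1}\langle A(x)\zeta,\zeta\rangle\le(Q+4-\delta)\min_{\|\zeta\|=1}\langle A(x)\zeta,\zeta\rangle\qquad\forall x\in\Omega.$$ Then for every compact set $O'\subset O$ with $O'\subseteq\Omega$ and every $\varepsilon>0$ with $2\varepsilon<d(O',\partial O):=\inf\{d(\xi^{-1}\circ x): x\in O',\ \xi\in\partial O\}$, $$\mathcal L_A h_\varepsilon(x)=\sum_{i,j=1}^m a_{ij}(x)X_iX_jh_\varepsilon(x)\ge C\lambda\qquad\forall x\in O'.$$ -/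

import Mathlib

open MeasureTheory Set Filter Topology
open scoped ContDiff Matrix

noncomputable section

namespace HType

/-- The underlying space `ℝ^N = ℝ^m × ℝ^n` of the group; its `volume` is Lebesgue measure. -/
abbrev Pt (m n : ℕ) : Type := (Fin m → ℝ) × (Fin n → ℝ)

/-- The dilations `δ_r (x₁, x₂) = (r x₁, r² x₂)`. -/
def dil {m n : ℕ} (r : ℝ) (x : Pt m n) : Pt m n := (r • x.1, r ^ 2 • x.2)

/-- A homogeneous Lie group `(ℝ^m × ℝ^n, ∘, δ_r)`: a smooth group law with identity `0` for which
the dilations `δ_r`, `r > 0`, are automorphisms. -/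
structure HomogeneousLieGroup (m n : ℕ) where
  mul : Pt m n → Pt m n → Pt m n
  inv : Pt m n → Pt m n
  mul_assoc : ∀ x y z, mul (mul x y) z = mul x (mul y z)
  zero_mul : ∀ x, mul 0 x = x
  mul_zero : ∀ x, mul x 0 = x
  inv_mul : ∀ x, mul (inv x) x = 0
  mul_inv : ∀ x, mul x (inv x) = 0
  contDiff_mul : ContDiff ℝ ∞ (fun p : Pt m n × Pt m n => mul p.1 p.2)
  contDiff_inv : ContDiff ℝ ∞ inv
  dil_mul : ∀ r : ℝ, 0 < r → ∀ x y, dil r (mul x y) = mul (dil r x) (dil r y)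

variable {m n : ℕ}

/-- The left-invariant vector field with value `w` at the identity. The Lie algebra `𝔤` of the group
is identified, as a vector space, with the tangent space `ℝ^N` at the identity. -/
def leftInv (G : HomogeneousLieGroup m n) (w : Pt m n) (x : Pt m n) : Pt m n :=
  fderiv ℝ (fun y => G.mul x y) 0 w

/-- The bracket of `𝔤`: the commutator of left-invariant vector fields. -/
def bracket (G : HomogeneousLieGroup m n) (v w : Pt m n) : Pt m n :=
  VectorField.lieBracket ℝ (leftInv G v) (leftInv G w) 0

/-- The center `𝔷` of `𝔤`. -/
def lieCenter (G : HomogeneousLieGroup m n) : Set (Pt m n) :=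
  {z | ∀ w, bracket G z w = 0}

/-- The orthogonal complement `𝔟 = 𝔷^⊥` of the center. -/
def horizontal (G : HomogeneousLieGroup m n) (g : LinearMap.BilinForm ℝ (Pt m n)) :
    Set (Pt m n) :=
  {v | ∀ z ∈ lieCenter G, g v z = 0}

/-- `J` restricts to the map `J_z : 𝔷^⊥ → 𝔷^⊥` given by `⟨J_z v, w⟩ = ⟨z, [v, w]⟩` for all
`w ∈ 𝔷^⊥`. -/
def IsJMap (G : HomogeneousLieGroup m n) (g : LinearMap.BilinForm ℝ (Pt m n))
    (z : Pt m n) (J : Pt m n → Pt m n) : Prop :=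
  ∀ v ∈ horizontal G g, J v ∈ horizontal G g ∧
    ∀ w ∈ horizontal G g, g (J v) w = g z (bracket G v w)

/-- The inner product `g` makes the Lie algebra of `G` an H-type algebra. -/
structure IsHType (G : HomogeneousLieGroup m n) (g : LinearMap.BilinForm ℝ (Pt m n)) : Prop where
  symm : ∀ v w, g v w = g w v
  pos : ∀ v, v ≠ 0 → 0 < g v v
  bracket_horizontal :
    (Submodule.span ℝ {u | ∃ v ∈ horizontal G g, ∃ w ∈ horizontal G g, u = bracket G v w} :
      Set (Pt m n)) = lieCenter G
  orthogonal : ∀ z ∈ lieCenter G, g z z = 1 → ∃ J : Pt m n → Pt m n, IsJMap G g z J ∧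
    ∀ v ∈ horizontal G g, ∀ w ∈ horizontal G g, g (J v) (J w) = g v w

/-- `X₁, …, X_m` is a `g`-orthonormal basis of `𝔷^⊥`. -/
structure IsHorizontalBasis (G : HomogeneousLieGroup m n) (g : LinearMap.BilinForm ℝ (Pt m n))
    (X : Fin m → Pt m n) : Prop where
  orthonormal : ∀ i j, g (X i) (X j) = if i = j then 1 else 0
  span : (Submodule.span ℝ (range X) : Set (Pt m n)) = horizontal G g

/-- `x = Exp w`: the integral curve of the left-invariant field of `w` issued from the identity is
at `x` at time one. -/
def IsExp (G : HomogeneousLieGroup m n) (w x : Pt m n) : Prop :=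
  ∃ γ : ℝ → Pt m n, γ 0 = 0 ∧ (∀ t, HasDerivAt γ (leftInv G w (γ t)) t) ∧ γ 1 = x

/-- The inverse `Log` of the exponential map. -/
def logMap (G : HomogeneousLieGroup m n) (x : Pt m n) : Pt m n :=
  Classical.epsilon (fun w => IsExp G w x)

/-- The component `v(x)` of `Log x` in `𝔷^⊥`. -/
def vPart (G : HomogeneousLieGroup m n) (g : LinearMap.BilinForm ℝ (Pt m n))
    (X : Fin m → Pt m n) (x : Pt m n) : Pt m n :=
  ∑ j, g (logMap G x) (X j) • X j

/-- The component `z(x)` of `Log x` in `𝔷`. -/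
def zPart (G : HomogeneousLieGroup m n) (g : LinearMap.BilinForm ℝ (Pt m n))
    (X : Fin m → Pt m n) (x : Pt m n) : Pt m n :=
  logMap G x - vPart G g X x

/-- The gauge `d(x) = (‖v(x)‖⁴ + 16 ‖z(x)‖²)^(1/4)`. -/
def gaugeNorm (G : HomogeneousLieGroup m n) (g : LinearMap.BilinForm ℝ (Pt m n))
    (X : Fin m → Pt m n) (x : Pt m n) : ℝ :=
  (g (vPart G g X x) (vPart G g X x) ^ 2 + 16 * g (zPart G g X x) (zPart G g X x)) ^ (1 / 4 : ℝ)

/-- The gauge ball `B_R(0)`. -/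
def gaugeBall (G : HomogeneousLieGroup m n) (g : LinearMap.BilinForm ℝ (Pt m n))
    (X : Fin m → Pt m n) (R : ℝ) : Set (Pt m n) :=
  {x | gaugeNorm G g X x < R}

/-- `inf {d(ξ⁻¹ ∘ x) : x ∈ S, ξ ∈ T}`. -/
def gaugeDist (G : HomogeneousLieGroup m n) (g : LinearMap.BilinForm ℝ (Pt m n))
    (X : Fin m → Pt m n) (S T : Set (Pt m n)) : ℝ :=
  sInf {r | ∃ x ∈ S, ∃ ξ ∈ T, r = gaugeNorm G g X (G.mul (G.inv ξ) x)}

/-- The derivative of `f` along the left-invariant field of `w`. -/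
def along (G : HomogeneousLieGroup m n) (w : Pt m n) (f : Pt m n → ℝ) (x : Pt m n) : ℝ :=
  fderiv ℝ f x (leftInv G w x)

/-- The operator `L_A = ∑ a_{ij}(x) X_i X_j`. -/
def opL (G : HomogeneousLieGroup m n) (X : Fin m → Pt m n)
    (A : Pt m n → Matrix (Fin m) (Fin m) ℝ) (f : Pt m n → ℝ) (x : Pt m n) : ℝ :=
  ∑ i, ∑ j, A x i j * along G (X i) (along G (X j) f) x

/-- The symmetric `m × m` matrices `M` with `lam ‖ξ‖² ≤ ⟨M ξ, ξ⟩ ≤ Lam ‖ξ‖²`. -/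
def IsElliptic (lam Lam : ℝ) (M : Matrix (Fin m) (Fin m) ℝ) : Prop :=
  M.IsSymm ∧ ∀ ξ : Fin m → ℝ,
    lam * (ξ ⬝ᵥ ξ) ≤ (M *ᵥ ξ) ⬝ᵥ ξ ∧ (M *ᵥ ξ) ⬝ᵥ ξ ≤ Lam * (ξ ⬝ᵥ ξ)

/-- The values of the quadratic form of `M` on the Euclidean unit sphere. -/
def sphereValues (M : Matrix (Fin m) (Fin m) ℝ) : Set ℝ :=
  {r | ∃ ξ : Fin m → ℝ, ξ ⬝ᵥ ξ = 1 ∧ r = (M *ᵥ ξ) ⬝ᵥ ξ}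

/-- The homogeneous dimension `Q = m + 2n`. -/
def homDim (m n : ℕ) : ℝ := (m : ℝ) + 2 * (n : ℝ)

/-- The `δ`-Landis condition at one point, `n` being the dimension of the center. -/
def Landis (n : ℕ) (δ : ℝ) (M : Matrix (Fin m) (Fin m) ℝ) : Prop :=
  M.trace + (homDim m n + 2 - (m : ℝ)) * sSup (sphereValues M) ≤
    (homDim m n + 4 - δ) * sInf (sphereValues M)

/-- The admissible cut-off functions `η_ε ∈ C^∞([0, ∞))`. -/
structure IsCutoff (ε : ℝ) (η : ℝ → ℝ) : Prop where
  smooth : ContDiffOn ℝ ∞ η (Ici 0)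
  nonneg : ∀ ρ, 0 ≤ ρ → 0 ≤ η ρ
  le_one : ∀ ρ, 0 ≤ ρ → η ρ ≤ 1
  eq_zero : ∀ ρ, 0 ≤ ρ → ρ < ε → η ρ = 0
  eq_one : ∀ ρ, 2 * ε ≤ ρ → η ρ = 1

/-- The kernel `ξ ↦ d(x⁻¹ ∘ ξ)^{-α}`. -/
def kernel (G : HomogeneousLieGroup m n) (g : LinearMap.BilinForm ℝ (Pt m n))
    (X : Fin m → Pt m n) (α : ℝ) (x ξ : Pt m n) : ℝ :=
  gaugeNorm G g X (G.mul (G.inv x) ξ) ^ (-α)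

/-- The truncated kernel `ξ ↦ η(d(x⁻¹ ∘ ξ)) d(x⁻¹ ∘ ξ)^{-α}`. -/
def cutKernel (G : HomogeneousLieGroup m n) (g : LinearMap.BilinForm ℝ (Pt m n))
    (X : Fin m → Pt m n) (α : ℝ) (η : ℝ → ℝ) (x ξ : Pt m n) : ℝ :=
  η (gaugeNorm G g X (G.mul (G.inv x) ξ)) * kernel G g X α x ξ

/-- `h(x) = -(1/α) ∫_O d(x⁻¹ ∘ ξ)^{-α} dξ`. -/
def barrier (G : HomogeneousLieGroup m n) (g : LinearMap.BilinForm ℝ (Pt m n))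
    (X : Fin m → Pt m n) (α : ℝ) (O : Set (Pt m n)) (x : Pt m n) : ℝ :=
  -(1 / α) * ∫ ξ in O, kernel G g X α x ξ

/-- `h_ε(x) = -(1/α) ∫_O η_ε(d(x⁻¹ ∘ ξ)) d(x⁻¹ ∘ ξ)^{-α} dξ`, with `η = η_ε`. -/
def cutBarrier (G : HomogeneousLieGroup m n) (g : LinearMap.BilinForm ℝ (Pt m n))
    (X : Fin m → Pt m n) (α : ℝ) (η : ℝ → ℝ) (O : Set (Pt m n)) (x : Pt m n) : ℝ :=
  -(1 / α) * ∫ ξ in O, cutKernel G g X α η x ξ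

end HType

end

/-! Write N = d^4 for the fourth power of the gauge and S for the squared norm of the horizontal
component. Homogeneity forces the group law to be x + y + b(x, y) with b bilinear on the first layer
and valued in the second (`exists_cocycle`). Hence Exp, Log, brackets and left-invariant fields are
explicit, N is a polynomial, and left translations are shears preserving Lebesgue measure.

The H-type condition gives |∇N|² = 16 S N (`sum_sq_gaugeGrad`) and an exact formula for the A-trace
of the horizontal Hessian of N (`sum_gaugeHess`). The Landis condition then becomes 4 N tr(A Hess N)
≤ (α + 4) ⟨A∇N, ∇N⟩ (`landis_bound`), which says that N^(-α/4) = d^(-α) satisfies L_A ≥ 0 off its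
pole.

The barrier carries the opposite sign, so the inequality is used on the complement of O. A constant
plus a smooth tail is added to the truncated kernel so that the new kernel F(N) has compact support
and differs from the old one by a constant for N ≤ σ, where σ bounds N(x⁻¹ ∘ ξ) over the unit ball.
The integral of F(N(x⁻¹ ∘ ξ)) over the whole group does not depend on x, so on O the function h_ε
equals a constant plus 1/α times the integral of F over the complement of O
(`cutBarrier_eq_add_const`). For x in O' that complement stays outside the 2ε-ball around x, where
the cut-off is 1 and F differs from the pure power only by the constant and the tail.

The tail is chosen so that F' is the derivative of the power times 1 - `step σ`. Differentiating
once more leaves the nonnegative Landis term and a term with the derivative of the step; ellipticity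
bounds the latter below by αλ times `lowerDensity` (`lowerDensity_le`). This density lives on σ ≤ N
≤ 2σ, hence entirely over the complement of O, so its integral is a positive constant independent of
O, ε, A and x (`le_opL_cutBarrier`).

Integrability of d^(-α) comes from a dyadic decomposition with α < Q. Uniform convergence holds
because the error is at most the integral of d^(-α) over a ball of radius 2ε, whatever the centre.
-/

noncomputable section

namespace HType

variable {m n : ℕ}

/-! ### Structure of the group law, left-invariant fields, Exp and Log -/

/-- A function, differentiable at the origin, which is homogeneous of degree one for a family of
anisotropic dilations factors through the derivative on the first layer. -/
theorem eq_fderiv_of_homogeneous {E F : Type*} [NormedAddCommGroup E] [NormedSpace ℝ E]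
    [NormedAddCommGroup F] [NormedSpace ℝ F] {f : E → F} (hf : DifferentiableAt ℝ f 0)
    (a b : E) (c : F) (h : ∀ r : ℝ, 0 < r → f (r • a + r ^ 2 • b) = r • c) :
    c = fderiv ℝ f 0 a := by
  have hcurve : HasDerivAt (fun r : ℝ => r • a + r ^ 2 • b) a 0 := by
    have h1 : HasDerivAt (fun r : ℝ => r • a) ((1 : ℝ) • a) 0 := (hasDerivAt_id (0 : ℝ)).smul_const a
    have h2 : HasDerivAt (fun r : ℝ => r ^ 2 • b) (((2 : ℕ) * (0 : ℝ) ^ (2 - 1)) • b) 0 :=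
      (hasDerivAt_pow 2 (0 : ℝ)).smul_const b
    simpa using h1.fun_add h2
  have hf' : HasFDerivAt f (fderiv ℝ f 0) ((0 : ℝ) • a + (0 : ℝ) ^ 2 • b) := by
    simpa using hf.hasFDerivAt
  have h1 := (hf'.comp_hasDerivAt (0 : ℝ) hcurve)
  have hcont : Tendsto (fun r : ℝ => f (r • a + r ^ 2 • b)) (𝓝[>] 0) (𝓝 (f 0)) := by
    have := h1.continuousAt.tendsto.mono_left (nhdsWithin_le_nhds (s := Ioi (0 : ℝ)))
    simpa [Function.comp_def] using this
  have hlim : Tendsto (fun r : ℝ => r • c) (𝓝[>] 0) (𝓝 0) := by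
    have : ContinuousAt (fun r : ℝ => r • c) 0 := by fun_prop
    simpa using this.tendsto.mono_left (nhdsWithin_le_nhds (s := Ioi (0 : ℝ)))
  have h0 : f 0 = 0 := by
    refine tendsto_nhds_unique hcont (hlim.congr' ?_)
    filter_upwards [self_mem_nhdsWithin] with r hr
    exact (h r hr).symm
  -- Homogeneity is known for r > 0 only, so the two derivatives of the same curve at 0 are compared
  -- on the half-line, where derivatives are still unique.
  have h2 : HasDerivWithinAt (fun r : ℝ => r • c) ((1 : ℝ) • c) (Ici 0) 0 :=
    ((hasDerivAt_id (0 : ℝ)).smul_const c).hasDerivWithinAt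
  have h3 : HasDerivWithinAt (fun r : ℝ => r • c) (fderiv ℝ f 0 a) (Ici 0) 0 := by
    refine h1.hasDerivWithinAt.congr (fun r hr => ?_) (by simp [h0])
    rcases eq_or_lt_of_le (show (0 : ℝ) ≤ r from hr) with rfl | hr
    · simp [h0]
    · exact (h r hr).symm
  simpa using (uniqueDiffOn_Ici (0 : ℝ) 0 (by simp)).eq_deriv _ h2 h3

theorem dil_eq (r : ℝ) (x : Pt m n) : dil r x = r • ((x.1, 0) : Pt m n) + r ^ 2 • ((0, x.2) : Pt m n) := by
  ext i <;> simp [dil]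

/-- The first component of the product is homogeneous of degree one on the product group, hence
linear in the pair; the identity axioms then determine it. -/
theorem mul_fst (G : HomogeneousLieGroup m n) (x y : Pt m n) :
    (G.mul x y).1 = x.1 + y.1 := by
  set f : Pt m n × Pt m n → (Fin m → ℝ) := fun p => (G.mul p.1 p.2).1 with hf
  have hfd : Differentiable ℝ f := (contDiff_fst.comp G.contDiff_mul).differentiable (by simp)
  have key : ∀ p : Pt m n × Pt m n, f p = fderiv ℝ f 0 ((p.1.1, 0), (p.2.1, 0)) := by
    intro p
    refine eq_fderiv_of_homogeneous (hfd 0) _ ((0, p.1.2), (0, p.2.2)) (f p) fun r hr => ?_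
    have : (r • (((p.1.1, 0), (p.2.1, 0)) : Pt m n × Pt m n) + r ^ 2 • ((0, p.1.2), (0, p.2.2)))
        = (dil r p.1, dil r p.2) := by
      simp [dil_eq]
    rw [this]
    simp only [hf, ← G.dil_mul r hr]
    rfl
  have hx : f (x, 0) = x.1 := by simp [hf, G.mul_zero]
  have hy : f (0, y) = y.1 := by simp [hf, G.zero_mul]
  have : f (x, y) = f (x, 0) + f (0, y) := by
    rw [key (x, y), key (x, 0), key (0, y), ← map_add]; simp
  rw [hx, hy] at this
  exact this

/-- The group law in the second layer is given by a bilinear map. -/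
theorem exists_cocycle (G : HomogeneousLieGroup m n) :
    ∃ b : (Fin m → ℝ) →L[ℝ] (Fin m → ℝ) →L[ℝ] (Fin n → ℝ),
      ∀ x y, G.mul x y = (x.1 + y.1, x.2 + y.2 + b x.1 y.1) := by
  set f : Pt m n × Pt m n → (Fin n → ℝ) := fun p => (G.mul p.1 p.2).2 with hf
  have hfs : ContDiff ℝ ∞ f := contDiff_snd.comp G.contDiff_mul
  have hfd : Differentiable ℝ f := hfs.differentiable (by simp)
  have hf's : ContDiff ℝ ∞ (fderiv ℝ f) := hfs.fderiv_right (by simp)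
  have hf'd : Differentiable ℝ (fderiv ℝ f) := hf's.differentiable (by simp)
  -- the dilation of the product group as a continuous linear map
  let D : ℝ → (Pt m n →L[ℝ] Pt m n) := fun r =>
    (r • ContinuousLinearMap.fst ℝ _ _).prod (r ^ 2 • ContinuousLinearMap.snd ℝ _ _)
  let DD : ℝ → (Pt m n × Pt m n →L[ℝ] Pt m n × Pt m n) := fun r => (D r).prodMap (D r)
  have hDD : ∀ r p, DD r p = (dil r p.1, dil r p.2) := fun r p => by
    rfl
  have hhom : ∀ r : ℝ, 0 < r → ∀ p, f (DD r p) = r ^ 2 • f p := by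
    intro r hr p
    rw [hDD]
    simp only [hf, ← G.dil_mul r hr]
    rfl
  -- Differentiating the degree-two homogeneity: first-layer derivatives of `f` become homogeneous
  -- of degree one, second-layer derivatives of degree zero.
  have hder : ∀ r : ℝ, 0 < r → ∀ p w, fderiv ℝ f (DD r p) (DD r w) = r ^ 2 • fderiv ℝ f p w := by
    intro r hr p w
    have h1 : HasFDerivAt (fun p => f (DD r p)) ((fderiv ℝ f (DD r p)).comp (DD r)) p :=
      (hfd (DD r p)).hasFDerivAt.comp p (DD r).hasFDerivAt
    have h2 : HasFDerivAt (fun p => f (DD r p)) (r ^ 2 • fderiv ℝ f p) p := by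
      simp_rw [hhom r hr]
      exact (hfd p).hasFDerivAt.const_smul (r ^ 2)
    exact congrArg (fun L => L w) (h1.unique h2)
  have hDDsmul : ∀ r : ℝ, ∀ p : Pt m n × Pt m n, DD r p =
      r • (((p.1.1, 0), (p.2.1, 0)) : Pt m n × Pt m n) + r ^ 2 • ((0, p.1.2), (0, p.2.2)) := by
    intro r p; rw [hDD]; simp [dil_eq]
  -- derivatives in the first layer are linear in the first layer
  have hlin : ∀ p, ∀ w : Fin m → ℝ, fderiv ℝ f p (0, (w, 0)) =
      fderiv ℝ (fderiv ℝ f) 0 ((p.1.1, 0), (p.2.1, 0)) (0, (w, 0)) := by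
    intro p w
    have hd : HasFDerivAt (fun p => fderiv ℝ f p (0, (w, 0)))
        ((fderiv ℝ (fderiv ℝ f) 0).flip (0, (w, 0))) 0 := by
      have := (hf'd 0).hasFDerivAt.clm_apply (hasFDerivAt_const ((0, (w, 0)) : Pt m n × Pt m n) 0)
      simpa using this
    have := eq_fderiv_of_homogeneous (f := fun p => fderiv ℝ f p (0, (w, 0))) hd.differentiableAt
      ((p.1.1, 0), (p.2.1, 0)) ((0, p.1.2), (0, p.2.2)) (fderiv ℝ f p (0, (w, 0))) (fun r hr => by
        have h1 := hder r hr p (0, (w, 0))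
        have h2 : DD r (0, (w, 0)) = r • (0, (w, 0)) := by simp [hDD, dil]
        rw [h2, map_smul, pow_two, mul_smul] at h1
        rw [← hDDsmul]
        exact smul_right_injective _ hr.ne' h1)
    rw [hd.fderiv] at this
    exact this
  -- derivatives in the second layer are constant
  have hcst : ∀ p, ∀ w : Fin n → ℝ, fderiv ℝ f p (0, (0, w)) = fderiv ℝ f 0 (0, (0, w)) := by
    intro p w
    have hcont : Continuous fun r : ℝ => fderiv ℝ f (DD r p) (0, (0, w)) := by
      have : Continuous fun r : ℝ => DD r p := by simp_rw [hDDsmul]; fun_prop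
      exact (hf's.continuous.comp this).clm_apply continuous_const
    have h0 := (hcont.tendsto 0).mono_left (nhdsWithin_le_nhds (s := Ioi (0 : ℝ)))
    have h1 : Tendsto (fun r : ℝ => fderiv ℝ f (DD r p) (0, (0, w))) (𝓝[>] 0)
        (𝓝 (fderiv ℝ f p (0, (0, w)))) := by
      refine tendsto_const_nhds.congr' ?_
      filter_upwards [self_mem_nhdsWithin] with r hr
      have hr' : (0 : ℝ) < r := hr
      have h1 := hder r hr' p (0, (0, w))
      have h2 : DD r (0, (0, w)) = r ^ 2 • (0, (0, w)) := by simp [hDD, dil]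
      rw [h2, map_smul] at h1
      exact (smul_right_injective _ (pow_ne_zero 2 hr'.ne') h1).symm
    have h2 : DD 0 p = 0 := by simp [hDDsmul]
    rw [h2] at h0
    exact tendsto_nhds_unique h1 h0
  have hy0 : ∀ x y w, HasFDerivAt (fun y => f (x, y)) ((fderiv ℝ f (x, y)).comp
      (ContinuousLinearMap.inr ℝ (Pt m n) (Pt m n))) y ∧
      (fderiv ℝ f (x, y)) (0, w) = fderiv ℝ f (x, y) (0, (w.1, 0)) + fderiv ℝ f (x, y) (0, (0, w.2)) := by
    intro x y w
    refine ⟨?_, by rw [← map_add]; simp⟩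
    have h : HasFDerivAt (fun y : Pt m n => (x, y)) (ContinuousLinearMap.inr ℝ (Pt m n) (Pt m n)) y :=
      hasFDerivAt_prodMk_right x y
    exact (hfd (x, y)).hasFDerivAt.comp y h
  have hid : ∀ y w, fderiv ℝ f (0, y) (0, w) = w.2 := by
    intro y w
    have h1 := (hy0 0 y w).1
    have h2 : (fun y => f (0, y)) = fun y : Pt m n => y.2 := by
      funext y; simp [hf, G.zero_mul]
    rw [h2] at h1
    have := h1.unique (hasFDerivAt_snd (𝕜 := ℝ) (p := y))
    simpa using congrArg (fun L => L w) this
  let ι : (Fin m → ℝ) →L[ℝ] Pt m n := ContinuousLinearMap.inl ℝ _ _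
  let b : (Fin m → ℝ) →L[ℝ] (Fin m → ℝ) →L[ℝ] (Fin n → ℝ) :=
    (((fderiv ℝ (fderiv ℝ f) 0).bilinearComp
      ((ContinuousLinearMap.inl ℝ (Pt m n) (Pt m n)).comp ι)
      ((ContinuousLinearMap.inr ℝ (Pt m n) (Pt m n)).comp ι)))
  have hb : ∀ x w, b x w = fderiv ℝ (fderiv ℝ f) 0 ((x, 0), 0) (0, (w, 0)) := fun x w => by
    simp [b, ι]
  refine ⟨b, fun x y => ?_⟩
  -- The first-layer derivative is linear in the pair of first components. Its dependence on `y`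
  -- drops out, because on the slice `x = 0` the map is just the projection `y ↦ y.2`.
  have hdy : ∀ y w, fderiv ℝ f (x, y) (0, w) = w.2 + b x.1 w.1 := by
    intro y w
    have h0 := hid y ((w.1, 0) : Pt m n)
    rw [hlin] at h0
    rw [(hy0 x y w).2, hlin, hcst, ← hcst (0, y), hid, hb, add_comm]
    congr 1
    have : (((x.1, 0), (y.1, 0)) : Pt m n × Pt m n) = ((x.1, 0), 0) + ((0, 0), (y.1, 0)) := by simp
    simp only [this, map_add, add_apply]
    simpa using h0
  have hz : ∀ y, HasFDerivAt (𝕜 := ℝ) (fun y : Pt m n => f (x, y) - (y.2 + b x.1 y.1))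
      (0 : Pt m n →L[ℝ] (Fin n → ℝ)) y := by
    intro y
    have h1 := (hy0 x y 0).1.fun_sub ((hasFDerivAt_snd (𝕜 := ℝ) (p := y)).fun_add
      ((b x.1).hasFDerivAt.comp y (hasFDerivAt_fst (𝕜 := ℝ) (p := y))))
    refine h1.congr_fderiv (ContinuousLinearMap.ext fun w => ?_)
    simp only [sub_apply, ContinuousLinearMap.comp_apply,
      ContinuousLinearMap.inr_apply, hdy, add_apply,
      ContinuousLinearMap.coe_snd', ContinuousLinearMap.coe_fst', sub_self,
      zero_apply]
  have hconst := is_const_of_fderiv_eq_zero (𝕜 := ℝ) (fun y => (hz y).differentiableAt)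
    (fun y => (hz y).fderiv) y 0
  refine Prod.ext (mul_fst G x y) ?_
  have hx0 : f (x, 0) = x.2 := by simp [hf, G.mul_zero]
  have hc : f (x, y) = x.2 + (y.2 + b x.1 y.1) := by
    have h3 : f (x, y) - (y.2 + b x.1 y.1) = x.2 := by
      simpa [hx0] using hconst
    rw [← h3]; abel
  change f (x, y) = _
  rw [hc]; simp [add_assoc]

/-- The bilinear map giving the group law in the second layer. -/
def cocycle (G : HomogeneousLieGroup m n) : (Fin m → ℝ) →L[ℝ] (Fin m → ℝ) →L[ℝ] (Fin n → ℝ) :=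
  Classical.choose (exists_cocycle G)

theorem mul_eq (G : HomogeneousLieGroup m n) (x y : Pt m n) :
    G.mul x y = (x.1 + y.1, x.2 + y.2 + cocycle G x.1 y.1) :=
  Classical.choose_spec (exists_cocycle G) x y

theorem inv_eq (G : HomogeneousLieGroup m n) (x : Pt m n) :
    G.inv x = (-x.1, -x.2 + cocycle G x.1 x.1) := by
  have h := G.mul_inv x
  rw [mul_eq] at h
  have h1 : (G.inv x).1 = -x.1 := (neg_eq_of_add_eq_zero_right (congrArg Prod.fst h)).symm
  have h2 : x.2 + (G.inv x).2 + cocycle G x.1 (G.inv x).1 = 0 := congrArg Prod.snd h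
  rw [h1, map_neg] at h2
  refine Prod.ext h1 ?_
  have : (G.inv x).2 = -x.2 + cocycle G x.1 x.1 + (x.2 + (G.inv x).2 + -cocycle G x.1 x.1) := by abel
  rw [this, h2, add_zero]

/-- The group law as a bilinear map with values in the second layer of the Lie algebra. -/
def twist (G : HomogeneousLieGroup m n) : Pt m n →L[ℝ] Pt m n →L[ℝ] Pt m n :=
  (ContinuousLinearMap.compL ℝ (Pt m n) (Fin n → ℝ) (Pt m n) (ContinuousLinearMap.inr ℝ _ _)).comp
    ((cocycle G).bilinearComp (ContinuousLinearMap.fst ℝ _ _) (ContinuousLinearMap.fst ℝ _ _))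

theorem twist_apply (G : HomogeneousLieGroup m n) (x y : Pt m n) :
    twist G x y = (0, cocycle G x.1 y.1) := by
  simp [twist]

theorem mul_eq_twist (G : HomogeneousLieGroup m n) (x y : Pt m n) :
    G.mul x y = x + y + twist G x y := by
  rw [mul_eq, twist_apply]
  exact Prod.ext (by simp) (by simp)

theorem inv_eq_twist (G : HomogeneousLieGroup m n) (x : Pt m n) :
    G.inv x = -x + twist G x x := by
  rw [inv_eq, twist_apply]; exact Prod.ext (by simp) (by simp)

theorem twist_twist_left (G : HomogeneousLieGroup m n) (x y w : Pt m n) :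
    twist G (twist G x y) w = 0 := by
  simp [twist_apply]

theorem twist_twist_right (G : HomogeneousLieGroup m n) (x y w : Pt m n) :
    twist G w (twist G x y) = 0 := by
  simp [twist_apply]

theorem leftInv_eq (G : HomogeneousLieGroup m n) (w x : Pt m n) :
    leftInv G w x = w + twist G x w := by
  have h : HasFDerivAt (fun y => G.mul x y)
      (ContinuousLinearMap.id ℝ (Pt m n) + twist G x) 0 := by
    simp_rw [mul_eq_twist]
    exact ((hasFDerivAt_id (𝕜 := ℝ) (0 : Pt m n)).const_add x).add (twist G x).hasFDerivAt
  rw [leftInv, h.fderiv]; simp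

theorem bracket_eq (G : HomogeneousLieGroup m n) (v w : Pt m n) :
    bracket G v w = twist G v w - twist G w v := by
  have h : ∀ w, HasFDerivAt (leftInv G w) ((twist G).flip w) 0 := by
    intro w
    have : leftInv G w = fun x => w + (twist G).flip w x := by
      funext x; simp [leftInv_eq]
    rw [this]
    exact ((twist G).flip w).hasFDerivAt.const_add w
  rw [bracket, VectorField.lieBracket, (h w).fderiv, (h v).fderiv]
  simp [leftInv_eq]

/-- The twist sees only first components, and along an integral curve these move on the straight
line `t • w.1`. The equation therefore has right-hand side `w + t • twist G w w`, which integrates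
explicitly and uniquely. -/
theorem isExp_iff (G : HomogeneousLieGroup m n) (w x : Pt m n) :
    IsExp G w x ↔ x = w + (1 / 2 : ℝ) • twist G w w := by
  have hsol : ∀ t : ℝ, HasDerivAt (fun t : ℝ => t • w + (t ^ 2 / 2) • twist G w w)
      (w + t • twist G w w) t := by
    intro t
    have h1 : HasDerivAt (fun r : ℝ => r • w) ((1 : ℝ) • w) t := (hasDerivAt_id t).smul_const w
    have h2 : HasDerivAt (fun t : ℝ => t ^ 2 / 2) t t := by
      have := (hasDerivAt_pow 2 t).div_const 2
      simpa using this
    simpa using h1.fun_add (h2.smul_const (twist G w w))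
  constructor
  · rintro ⟨γ, h0, hγ, rfl⟩
    simp_rw [leftInv_eq] at hγ
    have hfst : ∀ t, (γ t).1 = t • w.1 := by
      intro t
      have hd : ∀ t, HasDerivAt (fun t => (γ t).1 - t • w.1) 0 t := by
        intro t
        have h1 : HasDerivAt (fun t => (γ t).1) (w + twist G (γ t) w).1 t :=
          (hasFDerivAt_fst (𝕜 := ℝ) (p := γ t)).comp_hasDerivAt t (hγ t)
        have h2 : HasDerivAt (fun r : ℝ => r • w.1) ((1 : ℝ) • w.1) t :=
          (hasDerivAt_id t).smul_const w.1
        simpa [twist_apply] using h1.fun_sub h2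
      have := is_const_of_deriv_eq_zero (fun t => (hd t).differentiableAt) (fun t => (hd t).deriv) t 0
      simpa [h0, sub_eq_zero] using this
    have htw : ∀ t, twist G (γ t) w = t • twist G w w := by
      intro t; simp [twist_apply, hfst]
    have hd : ∀ t, HasDerivAt (fun t => γ t - (t • w + (t ^ 2 / 2) • twist G w w)) 0 t := by
      intro t
      have := (hγ t).fun_sub (hsol t)
      rw [htw] at this
      simpa using this
    have := is_const_of_deriv_eq_zero (fun t => (hd t).differentiableAt) (fun t => (hd t).deriv) 1 0
    simpa [h0, sub_eq_zero] using this
  · rintro rfl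
    refine ⟨fun t => t • w + (t ^ 2 / 2) • twist G w w, by simp, fun t => ?_, by simp⟩
    rw [leftInv_eq]
    simpa [twist_twist_left] using hsol t

/-- The relation in `isExp_iff` can be inverted exactly because a twist of a twist is zero; this
makes the choice in `logMap` unambiguous. -/
theorem logMap_eq (G : HomogeneousLieGroup m n) (x : Pt m n) :
    logMap G x = x - (1 / 2 : ℝ) • twist G x x := by
  have hex : IsExp G (x - (1 / 2 : ℝ) • twist G x x) x := by
    rw [isExp_iff]
    simp [twist_twist_left, twist_twist_right]
  have hspec := Classical.epsilon_spec (p := fun w => IsExp G w x) ⟨_, hex⟩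
  have h := (isExp_iff G _ _).1 hspec
  change x = logMap G x + (1 / 2 : ℝ) • twist G (logMap G x) (logMap G x) at h
  set u := logMap G x
  rw [h]
  simp [twist_twist_left, twist_twist_right]

/-! ### The bracket and the inner product as bilinear maps -/

/-- The bracket of the Lie algebra as a continuous bilinear map. -/
def bracketL (G : HomogeneousLieGroup m n) : Pt m n →L[ℝ] Pt m n →L[ℝ] Pt m n :=
  twist G - (twist G).flip

theorem bracket_eq_bracketL (G : HomogeneousLieGroup m n) (v w : Pt m n) :
    bracket G v w = bracketL G v w := by
  rw [bracket_eq]; rfl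

theorem bracketL_apply (G : HomogeneousLieGroup m n) (v w : Pt m n) :
    bracketL G v w = twist G v w - twist G w v := rfl

theorem bracketL_fst (G : HomogeneousLieGroup m n) (v w : Pt m n) : (bracketL G v w).1 = 0 := by
  simp [bracketL_apply, twist_apply]

theorem bracketL_swap (G : HomogeneousLieGroup m n) (v w : Pt m n) :
    bracketL G v w = -bracketL G w v := by
  simp [bracketL_apply]

theorem bracketL_self (G : HomogeneousLieGroup m n) (v : Pt m n) : bracketL G v v = 0 := by
  simp [bracketL_apply]

theorem bracketL_of_fst_eq_zero (G : HomogeneousLieGroup m n) {z : Pt m n} (hz : z.1 = 0)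
    (w : Pt m n) : bracketL G z w = 0 := by
  simp [bracketL_apply, twist_apply, hz]

theorem bracketL_congr (G : HomogeneousLieGroup m n) {v v' : Pt m n} (h : (v - v').1 = 0)
    (w : Pt m n) : bracketL G v w = bracketL G v' w := by
  have := bracketL_of_fst_eq_zero G h w
  rwa [map_sub, sub_apply, sub_eq_zero] at this

theorem mem_lieCenter_of_fst_eq_zero (G : HomogeneousLieGroup m n) {z : Pt m n} (hz : z.1 = 0) :
    z ∈ lieCenter G := fun w => by
  rw [bracket_eq_bracketL, bracketL_of_fst_eq_zero G hz]

/-- The scalar product as a continuous bilinear map. -/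
abbrev innerL (g : LinearMap.BilinForm ℝ (Pt m n)) : Pt m n →L[ℝ] Pt m n →L[ℝ] ℝ :=
  LinearMap.toContinuousBilinearMap g

/-! ### H-type algebra and the Landis inequality -/

section Algebra

variable {G : HomogeneousLieGroup m n} {g : LinearMap.BilinForm ℝ (Pt m n)} {X : Fin m → Pt m n}

theorem IsHorizontalBasis.mem_horizontal (hX : IsHorizontalBasis G g X) (j : Fin m) :
    X j ∈ horizontal G g := by
  rw [← hX.span]; exact Submodule.subset_span ⟨j, rfl⟩

theorem IsHorizontalBasis.inner_right_eq_zero (hX : IsHorizontalBasis G g X) {z : Pt m n}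
    (hz : z.1 = 0) (j : Fin m) : g (X j) z = 0 :=
  hX.mem_horizontal j z (mem_lieCenter_of_fst_eq_zero G hz)

theorem IsHorizontalBasis.inner_left_eq_zero (hX : IsHorizontalBasis G g X) (hG : IsHType G g)
    {z : Pt m n} (hz : z.1 = 0) (j : Fin m) : g z (X j) = 0 := by
  rw [hG.symm]; exact hX.inner_right_eq_zero hz j

theorem IsHorizontalBasis.inner_sum (hX : IsHorizontalBasis G g X) (c : Fin m → ℝ) (i : Fin m) :
    g (∑ j, c j • X j) (X i) = c i := by
  simp [map_sum, LinearMap.sum_apply, hX.orthonormal]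

/-- The second layer is central, so a combination of the `X j` with zero first component is
orthogonal to every `X i` and vanishes. Projection of the span to the first layer is thus injective,
hence onto by dimension: the horizontal space is a graph over the first layer, not necessarily the
first layer itself. -/
theorem IsHorizontalBasis.exists_coeff (hX : IsHorizontalBasis G g X) (hG : IsHType G g)
    (a : Fin m → ℝ) : ∃ c : Fin m → ℝ, (∑ j, c j • X j).1 = a := by
  let T : (Fin m → ℝ) →ₗ[ℝ] (Fin m → ℝ) :=
    (LinearMap.fst ℝ (Fin m → ℝ) (Fin n → ℝ)).comp (Fintype.linearCombination ℝ X)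
  have hT : ∀ c, T c = (∑ j, c j • X j).1 := fun c => by
    simp [T, Fintype.linearCombination_apply]
  have hinj : Function.Injective T := by
    rw [injective_iff_map_eq_zero]
    intro c hc
    rw [hT] at hc
    funext i
    rw [← hX.inner_sum c i, hX.inner_left_eq_zero hG hc]
    rfl
  obtain ⟨c, hc⟩ := (LinearMap.injective_iff_surjective.1 hinj) a
  exact ⟨c, by rw [← hT, hc]⟩

/-- Subtracting the orthogonal projection to the horizontal space lands in the second layer. -/
theorem IsHorizontalBasis.sub_proj_fst (hX : IsHorizontalBasis G g X) (hG : IsHType G g)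
    (x : Pt m n) : (x - ∑ j, g x (X j) • X j).1 = 0 := by
  obtain ⟨c, hc⟩ := hX.exists_coeff hG x.1
  have h : (x - ∑ j, c j • X j).1 = 0 := by rw [Prod.fst_sub, hc, sub_self]
  have hcx : ∀ i, g x (X i) = c i := by
    intro i
    have := hX.inner_left_eq_zero hG h i
    rw [map_sub, LinearMap.sub_apply, hX.inner_sum, sub_eq_zero] at this
    exact this
  simpa only [hcx] using h

/-- With an empty first layer every bracket is zero, so the brackets could not span a center
containing the nonzero second layer. -/
theorem IsHorizontalBasis.pos_dim (hX : IsHorizontalBasis G g X) (hG : IsHType G g) (hn : 0 < n) :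
    0 < m := by
  rcases Nat.eq_zero_or_pos m with rfl | h
  · exfalso
    have hz : ((0, fun _ => 1) : Pt 0 n) ∈ lieCenter G := mem_lieCenter_of_fst_eq_zero G rfl
    rw [← hG.bracket_horizontal] at hz
    have hb : ∀ u ∈ {u | ∃ v ∈ horizontal G g, ∃ w ∈ horizontal G g, u = bracket G v w},
        u = 0 := by
      rintro u ⟨v, -, w, -, rfl⟩
      rw [bracket_eq_bracketL, bracketL_of_fst_eq_zero G (Subsingleton.elim _ _)]
    rw [Submodule.span_eq_bot.2 hb] at hz
    have := congrFun (congrArg Prod.snd ((Submodule.mem_bot ℝ).1 hz)) ⟨0, hn⟩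
    simp at this
  · exact h

theorem logMap_inner (hG : IsHType G g) (hX : IsHorizontalBasis G g X) (x : Pt m n) (j : Fin m) :
    g (logMap G x) (X j) = g x (X j) := by
  rw [logMap_eq, map_sub, LinearMap.sub_apply, map_smul, LinearMap.smul_apply,
    hX.inner_left_eq_zero hG (z := twist G x x) (by simp [twist_apply])]
  simp

theorem vPart_eq (hG : IsHType G g) (hX : IsHorizontalBasis G g X) (x : Pt m n) :
    vPart G g X x = ∑ j, g x (X j) • X j := by
  simp only [vPart, logMap_inner hG hX]

theorem zPart_eq (hG : IsHType G g) (hX : IsHorizontalBasis G g X) (x : Pt m n) :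
    zPart G g X x = x - (1 / 2 : ℝ) • twist G x x - ∑ j, g x (X j) • X j := by
  rw [zPart, vPart_eq hG hX, logMap_eq]

theorem zPart_fst (hG : IsHType G g) (hX : IsHorizontalBasis G g X) (x : Pt m n) :
    (zPart G g X x).1 = 0 := by
  have := hX.sub_proj_fst hG x
  rw [zPart_eq hG hX]
  simpa [twist_apply] using this

theorem inner_horizontal (hX : IsHorizontalBasis G g X) {v : Pt m n} (hv : v ∈ horizontal G g) :
    v = ∑ j, g v (X j) • X j := by
  rw [← hX.span] at hv
  obtain ⟨c, rfl⟩ := (Submodule.mem_span_range_iff_exists_fun ℝ).1 hv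
  simp only [hX.inner_sum]

theorem inner_sum_sum (hX : IsHorizontalBasis G g X) (c d : Fin m → ℝ) :
    g (∑ j, c j • X j) (∑ j, d j • X j) = ∑ j, c j * d j := by
  rw [map_sum]
  simp only [map_smul, hX.inner_sum, smul_eq_mul]
  exact Finset.sum_congr rfl fun j _ => mul_comm _ _

/-- The squared norm of the horizontal component. -/
def horSq (g : LinearMap.BilinForm ℝ (Pt m n)) (X : Fin m → Pt m n) (x : Pt m n) : ℝ :=
  ∑ j, g x (X j) ^ 2

theorem horSq_nonneg (x : Pt m n) : 0 ≤ horSq g X x := Finset.sum_nonneg fun _ _ => sq_nonneg _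

theorem vPart_inner (hG : IsHType G g) (hX : IsHorizontalBasis G g X) (x : Pt m n) :
    g (vPart G g X x) (vPart G g X x) = horSq g X x := by
  rw [vPart_eq hG hX, inner_sum_sum hX, horSq]
  exact Finset.sum_congr rfl fun j _ => (sq _).symm

theorem sum_horizontal_mem (hX : IsHorizontalBasis G g X) (c : Fin m → ℝ) :
    ∑ j, c j • X j ∈ horizontal G g := by
  rw [← hX.span]
  exact Submodule.sum_mem _ fun j _ => Submodule.smul_mem _ _ (Submodule.subset_span ⟨j, rfl⟩)

theorem bracketL_proj (hG : IsHType G g) (hX : IsHorizontalBasis G g X) (x w : Pt m n) :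
    bracketL G x w = bracketL G (∑ j, g x (X j) • X j) w :=
  bracketL_congr G (hX.sub_proj_fst hG x) w

/-- The map `J_z` multiplies norms by the norm of `z`. -/
theorem sum_sq_inner_bracket (hG : IsHType G g) (hX : IsHorizontalBasis G g X) {z : Pt m n}
    (hz : z.1 = 0) (x : Pt m n) :
    ∑ i, g z (bracketL G x (X i)) ^ 2 = g z z * horSq g X x := by
  rcases eq_or_ne z 0 with rfl | hz0
  · simp
  have hpos := hG.pos z hz0
  set s := Real.sqrt (g z z) with hs
  have hs0 : 0 < s := Real.sqrt_pos.2 hpos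
  have hss : s * s = g z z := Real.mul_self_sqrt hpos.le
  -- Orthogonality of `J` is assumed for unit central vectors only, so `z` is normalised and the
  -- factor `s` restored afterwards.
  have hzc : s⁻¹ • z ∈ lieCenter G := mem_lieCenter_of_fst_eq_zero G (by simp [hz])
  have hnorm : g (s⁻¹ • z) (s⁻¹ • z) = 1 := by
    simp only [map_smul, LinearMap.smul_apply, smul_eq_mul, ← hss]
    field_simp
  obtain ⟨J, hJ, hJo⟩ := hG.orthogonal _ hzc hnorm
  set v := ∑ j, g x (X j) • X j with hv
  have hvh : v ∈ horizontal G g := sum_horizontal_mem hX _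
  have hJv := inner_horizontal hX (hJ v hvh).1
  have h1 : g (J v) (J v) = ∑ i, g (J v) (X i) ^ 2 := by
    conv_lhs => rw [hJv]
    rw [inner_sum_sum hX]
    exact Finset.sum_congr rfl fun j _ => (sq _).symm
  have h2 : ∀ i, g z (bracketL G x (X i)) = s * g (J v) (X i) := by
    intro i
    rw [(hJ v hvh).2 _ (hX.mem_horizontal i), bracket_eq_bracketL, bracketL_proj hG hX x, ← hv,
      map_smul, LinearMap.smul_apply, smul_eq_mul]
    field_simp
  have h3 : g v v = horSq g X x := by
    rw [← vPart_inner hG hX, vPart_eq hG hX]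
  simp only [h2, mul_pow, ← Finset.mul_sum]
  rw [← h1, hJo v hvh v hvh, h3, ← hss, sq]

/-- This is ⟨J_z v, v⟩ = ⟨z, [v, v]⟩ = 0 in coordinates; it removes the cross term from the squared
gradient of the gauge. -/
theorem sum_inner_bracket_self (hG : IsHType G g) (hX : IsHorizontalBasis G g X) (z x : Pt m n) :
    ∑ i, g x (X i) * g z (bracketL G x (X i)) = 0 := by
  have : ∑ i, g x (X i) * g z (bracketL G x (X i)) =
      g z (bracketL G x (∑ i, g x (X i) • X i)) := by
    simp [map_sum]
  rw [this, bracketL_proj hG hX, bracketL_self, map_zero]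

/-- Splitting the vertical part of the Hessian along an orthonormal basis of the second layer turns
it into `n` quadratic forms of A, one at each vector J_{e k} v, all of the same length as v. -/
theorem exists_vertical_orthonormal (hG : IsHType G g) :
    ∃ e : Fin n → Pt m n, (∀ k, (e k).1 = 0) ∧ (∀ k, g (e k) (e k) = 1) ∧
      ∀ u w : Pt m n, u.1 = 0 → w.1 = 0 → g u w = ∑ k, g (e k) u * g (e k) w := by
  let B : LinearMap.BilinForm ℝ (Fin n → ℝ) :=
    g.compl₁₂ (LinearMap.inr ℝ (Fin m → ℝ) (Fin n → ℝ)) (LinearMap.inr ℝ (Fin m → ℝ) (Fin n → ℝ))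
  have hB : ∀ u w, B u w = g (0, u) (0, w) := fun u w => rfl
  have hsymm : LinearMap.IsSymm B := ⟨fun u w => by simp [hB, hG.symm (0, u)]⟩
  obtain ⟨v0, hv0⟩ := LinearMap.BilinForm.exists_orthogonal_basis hsymm
  let v := v0.reindex (finCongr (Module.finrank_fin_fun ℝ (n := n)))
  have hv : ∀ i j, i ≠ j → B (v i) (v j) = 0 := by
    intro i j hij
    simp only [v, Module.Basis.reindex_apply]
    exact hv0 (fun h => hij (by simpa using h))
  have hpos : ∀ k, 0 < B (v k) (v k) := by
    intro k
    rw [hB]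
    refine hG.pos _ fun h => v.ne_zero k ?_
    exact congrArg Prod.snd h
  let s : Fin n → ℝ := fun k => Real.sqrt (B (v k) (v k))
  have hs : ∀ k, 0 < s k := fun k => Real.sqrt_pos.2 (hpos k)
  have hss : ∀ k, B (v k) (v k) = s k * s k := fun k => (Real.mul_self_sqrt (hpos k).le).symm
  refine ⟨fun k => (s k)⁻¹ • (0, v k), fun k => by simp, fun k => ?_, fun u w hu hw => ?_⟩
  · simp only [map_smul, LinearMap.smul_apply, smul_eq_mul, ← hB, hss]
    have := hs k
    field_simp
  · obtain ⟨u1, u2⟩ := u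
    obtain ⟨w1, w2⟩ := w
    simp only at hu hw
    subst hu hw
    have hc : ∀ k, B (v k) u2 = v.repr u2 k * B (v k) (v k) := by
      intro k
      conv_lhs => rw [← v.sum_repr u2]
      rw [map_sum, Finset.sum_eq_single k]
      · simp
      · intro j _ hj; simp [hv k j hj.symm]
      · simp
    have h1 : B u2 w2 = ∑ k, v.repr u2 k * B (v k) w2 := by
      conv_lhs => rw [← v.sum_repr u2]
      rw [map_sum, LinearMap.sum_apply]
      exact Finset.sum_congr rfl fun k _ => by rw [map_smul, LinearMap.smul_apply, smul_eq_mul]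
    rw [← hB, h1]
    refine Finset.sum_congr rfl fun k _ => ?_
    simp only [map_smul, LinearMap.smul_apply, smul_eq_mul, ← hB, hc, hss]
    have := hs k
    field_simp

/-! ### Horizontal gradient and Hessian of the gauge, and the Landis bound -/

/-- The fourth power of the gauge. -/
def gaugePow (G : HomogeneousLieGroup m n) (g : LinearMap.BilinForm ℝ (Pt m n))
    (X : Fin m → Pt m n) (x : Pt m n) : ℝ :=
  horSq g X x ^ 2 + 16 * g (zPart G g X x) (zPart G g X x)

theorem IsHType.nonneg (hG : IsHType G g) (v : Pt m n) : 0 ≤ g v v := by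
  rcases eq_or_ne v 0 with rfl | h
  · simp
  · exact (hG.pos v h).le

theorem gaugePow_nonneg (hG : IsHType G g) (x : Pt m n) : 0 ≤ gaugePow G g X x :=
  add_nonneg (sq_nonneg _) (mul_nonneg (by norm_num) (hG.nonneg _))

theorem gaugeNorm_eq (hG : IsHType G g) (hX : IsHorizontalBasis G g X) (x : Pt m n) :
    gaugeNorm G g X x = gaugePow G g X x ^ (1 / 4 : ℝ) := by
  rw [gaugeNorm, vPart_inner hG hX, gaugePow]

/-- The horizontal gradient of the fourth power of the gauge. -/
def gaugeGrad (G : HomogeneousLieGroup m n) (g : LinearMap.BilinForm ℝ (Pt m n))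
    (X : Fin m → Pt m n) (x : Pt m n) (i : Fin m) : ℝ :=
  4 * horSq g X x * g x (X i) + 16 * g (zPart G g X x) (bracketL G x (X i))

/-- The horizontal second derivatives of the fourth power of the gauge. -/
def gaugeHess (G : HomogeneousLieGroup m n) (g : LinearMap.BilinForm ℝ (Pt m n))
    (X : Fin m → Pt m n) (x : Pt m n) (i j : Fin m) : ℝ :=
  8 * g x (X i) * g x (X j) + 4 * horSq g X x * (if i = j then 1 else 0)
    + 8 * g (bracketL G x (X i)) (bracketL G x (X j)) + 16 * g (zPart G g X x) (bracketL G (X i) (X j))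

/-- The gradient is 4 S v + 16 J_z v up to the sign convention for J. The two pieces are orthogonal
and |J_z v|² = |z|² S, so the squared length is 16 S (S² + 16 |z|²). -/
theorem sum_sq_gaugeGrad (hG : IsHType G g) (hX : IsHorizontalBasis G g X) (x : Pt m n) :
    gaugeGrad G g X x ⬝ᵥ gaugeGrad G g X x = 16 * horSq g X x * gaugePow G g X x := by
  have h1 := sum_sq_inner_bracket hG hX (zPart_fst hG hX x) x
  have h2 := sum_inner_bracket_self hG hX (zPart G g X x) x
  have h3 : gaugeGrad G g X x ⬝ᵥ gaugeGrad G g X x =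
      16 * horSq g X x ^ 2 * (∑ i, g x (X i) ^ 2)
      + 128 * horSq g X x * (∑ i, g x (X i) * g (zPart G g X x) (bracketL G x (X i)))
      + 256 * ∑ i, g (zPart G g X x) (bracketL G x (X i)) ^ 2 := by
    simp only [dotProduct, gaugeGrad, Finset.mul_sum, ← Finset.sum_add_distrib]
    exact Finset.sum_congr rfl fun i _ => by ring
  rw [h3, h1, h2, gaugePow]
  change 16 * horSq g X x ^ 2 * horSq g X x + _ + _ = _
  ring

theorem quadForm_eq (A : Matrix (Fin m) (Fin m) ℝ) (u : Fin m → ℝ) :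
    (A *ᵥ u) ⬝ᵥ u = ∑ i, ∑ j, A i j * (u i * u j) := by
  simp only [dotProduct, Matrix.mulVec, Finset.sum_mul]
  exact Finset.sum_congr rfl fun i _ => Finset.sum_congr rfl fun j _ => by ring

/-- The brackets of the fields `X i` and `X j` form the antisymmetric part of the Hessian and cancel
against the symmetric matrix; only quadratic forms of A and its trace survive. -/
theorem sum_gaugeHess
    {A : Matrix (Fin m) (Fin m) ℝ} (hA : A.IsSymm) {e : Fin n → Pt m n}
    (he : ∀ u w : Pt m n, u.1 = 0 → w.1 = 0 → g u w = ∑ k, g (e k) u * g (e k) w) (x : Pt m n) :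
    ∑ i, ∑ j, A i j * gaugeHess G g X x i j =
      8 * ((A *ᵥ fun i => g x (X i)) ⬝ᵥ fun i => g x (X i)) + 4 * horSq g X x * A.trace
      + 8 * ∑ k, (A *ᵥ fun i => g (e k) (bracketL G x (X i))) ⬝ᵥ
          fun i => g (e k) (bracketL G x (X i)) := by
  have hanti : ∑ i, ∑ j, A i j * g (zPart G g X x) (bracketL G (X i) (X j)) = 0 := by
    have h : ∑ i, ∑ j, A i j * g (zPart G g X x) (bracketL G (X i) (X j)) =
        -∑ i, ∑ j, A i j * g (zPart G g X x) (bracketL G (X i) (X j)) := by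
      conv_lhs => rw [Finset.sum_comm]
      simp only [← Finset.sum_neg_distrib]
      refine Finset.sum_congr rfl fun i _ => Finset.sum_congr rfl fun j _ => ?_
      rw [bracketL_swap, hA.apply]
      simp
    linarith
  have htr : ∑ i, ∑ j, A i j * (if i = j then (1 : ℝ) else 0) = A.trace := by
    simp [Matrix.trace]
  have hvert : ∑ i, ∑ j, A i j * g (bracketL G x (X i)) (bracketL G x (X j)) =
      ∑ k, (A *ᵥ fun i => g (e k) (bracketL G x (X i))) ⬝ᵥ
          fun i => g (e k) (bracketL G x (X i)) := by
    simp only [quadForm_eq, he _ _ (bracketL_fst G x _) (bracketL_fst G x _), Finset.mul_sum]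
    conv_rhs => rw [Finset.sum_comm]
    refine Finset.sum_congr rfl fun i _ => ?_
    conv_rhs => rw [Finset.sum_comm]
  rw [← hvert, ← htr, quadForm_eq]
  have : ∑ i, ∑ j, A i j * gaugeHess G g X x i j =
      8 * (∑ i, ∑ j, A i j * (g x (X i) * g x (X j)))
      + 4 * horSq g X x * (∑ i, ∑ j, A i j * (if i = j then (1 : ℝ) else 0))
      + 8 * (∑ i, ∑ j, A i j * g (bracketL G x (X i)) (bracketL G x (X j)))
      + 16 * ∑ i, ∑ j, A i j * g (zPart G g X x) (bracketL G (X i) (X j)) := by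
    simp only [Finset.mul_sum, ← Finset.sum_add_distrib]
    refine Finset.sum_congr rfl fun i _ => Finset.sum_congr rfl fun j _ => ?_
    rw [gaugeHess]; ring
  rw [this, hanti, mul_zero, add_zero]

theorem quadForm_smul (A : Matrix (Fin m) (Fin m) ℝ) (c : ℝ) (u : Fin m → ℝ) :
    (A *ᵥ (c • u)) ⬝ᵥ (c • u) = c ^ 2 * ((A *ᵥ u) ⬝ᵥ u) := by
  rw [Matrix.mulVec_smul, smul_dotProduct, dotProduct_smul, smul_eq_mul, smul_eq_mul]
  ring

/-- Ellipticity enters only to make the values on the sphere bounded, so that their real `sInf` and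
`sSup` are genuine bounds; scaling does the rest. -/
theorem IsElliptic.quadForm_bounds {lam Lam : ℝ} {A : Matrix (Fin m) (Fin m) ℝ}
    (hA : IsElliptic lam Lam A) (u : Fin m → ℝ) :
    sInf (sphereValues A) * (u ⬝ᵥ u) ≤ (A *ᵥ u) ⬝ᵥ u ∧
      (A *ᵥ u) ⬝ᵥ u ≤ sSup (sphereValues A) * (u ⬝ᵥ u) := by
  have hbdd : ∀ r ∈ sphereValues A, lam ≤ r ∧ r ≤ Lam := by
    rintro r ⟨ξ, hξ, rfl⟩
    have := hA.2 ξ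
    simpa [hξ] using this
  rcases eq_or_ne u 0 with rfl | hu
  · simp
  have hpos : 0 < u ⬝ᵥ u := by
    rcases (show 0 ≤ u ⬝ᵥ u from Finset.sum_nonneg fun i _ => mul_self_nonneg (u i)).lt_or_eq with h | h
    · exact h
    · exact absurd (dotProduct_self_eq_zero.1 h.symm) hu
  set s := Real.sqrt (u ⬝ᵥ u) with hs
  have hs0 : 0 < s := Real.sqrt_pos.2 hpos
  have hss : s ^ 2 = u ⬝ᵥ u := Real.sq_sqrt hpos.le
  have hmem : (s⁻¹ ^ 2) * ((A *ᵥ u) ⬝ᵥ u) ∈ sphereValues A := by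
    refine ⟨s⁻¹ • u, ?_, (quadForm_smul A _ u).symm⟩
    rw [smul_dotProduct, dotProduct_smul, smul_eq_mul, smul_eq_mul, ← hss]
    field_simp
  have h1 := csInf_le ⟨lam, fun r hr => (hbdd r hr).1⟩ hmem
  have h2 := le_csSup ⟨Lam, fun r hr => (hbdd r hr).2⟩ hmem
  rw [← hss]
  have h3 : s ^ 2 * (s⁻¹ ^ 2 * ((A *ᵥ u) ⬝ᵥ u)) = (A *ᵥ u) ⬝ᵥ u := by field_simp
  constructor
  · rw [← h3, mul_comm]; exact mul_le_mul_of_nonneg_left h1 (sq_nonneg _)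
  · rw [← h3, mul_comm _ (s ^ 2)]; exact mul_le_mul_of_nonneg_left h2 (sq_nonneg _)

/-- The Landis condition bounds the second-order term by the gradient term. -/
theorem landis_bound (hG : IsHType G g) (hX : IsHorizontalBasis G g X) {lam Lam δ : ℝ}
    (hδ : δ ≤ 2) {A : Matrix (Fin m) (Fin m) ℝ} (hA : IsElliptic lam Lam A)
    (hL : Landis n δ A) (x : Pt m n) :
    4 * gaugePow G g X x * ∑ i, ∑ j, A i j * gaugeHess G g X x i j ≤
      (homDim m n + 4 - δ) * ((A *ᵥ gaugeGrad G g X x) ⬝ᵥ gaugeGrad G g X x) := by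
  obtain ⟨e, he0, he1, he⟩ := exists_vertical_orthonormal hG
  set a := sInf (sphereValues A)
  set M := sSup (sphereValues A)
  set S := horSq g X x with hS
  have hS0 : 0 ≤ S := horSq_nonneg x
  have hN0 : 0 ≤ gaugePow G g X x := gaugePow_nonneg hG x
  have hv : (fun i => g x (X i)) ⬝ᵥ (fun i => g x (X i)) = S := by
    simp [dotProduct, hS, horSq, sq]
  have h1 := (hA.quadForm_bounds fun i => g x (X i)).2
  rw [hv] at h1
  have h2 : ∑ k, (A *ᵥ fun i => g (e k) (bracketL G x (X i))) ⬝ᵥ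
      (fun i => g (e k) (bracketL G x (X i))) ≤ n * (M * S) := by
    have : ∀ k ∈ Finset.univ, (A *ᵥ fun i => g (e k) (bracketL G x (X i))) ⬝ᵥ
      (fun i => g (e k) (bracketL G x (X i))) ≤ M * S := by
      intro k _
      have := (hA.quadForm_bounds fun i => g (e k) (bracketL G x (X i))).2
      have h3 := sum_sq_inner_bracket hG hX (he0 k) x
      rw [he1, one_mul] at h3
      have h4 : (fun i => g (e k) (bracketL G x (X i))) ⬝ᵥ
          (fun i => g (e k) (bracketL G x (X i))) = S := by
        rw [← hS] at h3
        rw [← h3]; simp [dotProduct, sq]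
      rwa [h4] at this
    simpa using Finset.sum_le_card_nsmul _ _ _ this
  have hE := (hA.quadForm_bounds (gaugeGrad G g X x)).1
  rw [sum_sq_gaugeGrad hG hX, ← hS] at hE
  have hQ : 0 ≤ homDim m n + 4 - δ := by
    have : 0 ≤ homDim m n := by unfold homDim; positivity
    linarith
  -- The weight Q + 2 - m is 2n + 2: after division by 4 S, the `n` vertical forms give 2 n M and
  -- the horizontal form gives 2 M.
  have hLan : A.trace + (2 * n + 2) * M ≤ (homDim m n + 4 - δ) * a := by
    have h := hL
    unfold Landis at h
    convert h using 3
    unfold homDim; ring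
  have hsum : ∑ i, ∑ j, A i j * gaugeHess G g X x i j ≤ 4 * S * ((homDim m n + 4 - δ) * a) := by
    rw [sum_gaugeHess hA.1 he x]
    have := mul_le_mul_of_nonneg_left hLan (mul_nonneg (by norm_num : (0 : ℝ) ≤ 4) hS0)
    linarith
  calc 4 * gaugePow G g X x * ∑ i, ∑ j, A i j * gaugeHess G g X x i j
      ≤ 4 * gaugePow G g X x * (4 * S * ((homDim m n + 4 - δ) * a)) :=
        mul_le_mul_of_nonneg_left hsum (mul_nonneg (by norm_num) hN0)
    _ = (homDim m n + 4 - δ) * (a * (16 * S * gaugePow G g X x)) := by ring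
    _ ≤ _ := mul_le_mul_of_nonneg_left hE hQ

end Algebra

/-! ### Differentiation along left-invariant fields, translations and inversion -/

section Calculus

variable {G : HomogeneousLieGroup m n} {g : LinearMap.BilinForm ℝ (Pt m n)} {X : Fin m → Pt m n}

theorem contDiff_inner {E : Type*} [NormedAddCommGroup E] [NormedSpace ℝ E]
    (g : LinearMap.BilinForm ℝ (Pt m n)) {k : WithTop ℕ∞} {f h : E → Pt m n}
    (hf : ContDiff ℝ k f) (hh : ContDiff ℝ k h) : ContDiff ℝ k fun x => g (f x) (h x) :=
  ((innerL g).contDiff.comp hf).clm_apply hh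

theorem hasFDerivAt_inner {g : LinearMap.BilinForm ℝ (Pt m n)} {f h : Pt m n → Pt m n}
    {f' h' : Pt m n →L[ℝ] Pt m n} {x : Pt m n} (hf : HasFDerivAt f f' x)
    (hh : HasFDerivAt h h' x) : ∃ L : Pt m n →L[ℝ] ℝ, HasFDerivAt (fun y => g (f y) (h y)) L x ∧
      ∀ w, L w = g (f' w) (h x) + g (f x) (h' w) :=
  ⟨_, (innerL g).hasFDerivAt_of_bilinear hf hh, fun w => by simp [add_comm]⟩

theorem contDiff_horSq (g : LinearMap.BilinForm ℝ (Pt m n)) (X : Fin m → Pt m n)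
    {k : WithTop ℕ∞} : ContDiff ℝ k (horSq g X) :=
  ContDiff.sum fun _ _ => (contDiff_inner g contDiff_id contDiff_const).pow 2

theorem contDiff_zPart (hG : IsHType G g) (hX : IsHorizontalBasis G g X) {k : WithTop ℕ∞} :
    ContDiff ℝ k (zPart G g X) := by
  rw [funext (zPart_eq hG hX)]
  have h1 : ContDiff ℝ k fun x => twist G x x := (twist G).contDiff.clm_apply contDiff_id
  exact (contDiff_id.sub (h1.const_smul _)).sub
    (ContDiff.sum fun j _ => (contDiff_inner g contDiff_id contDiff_const).smul contDiff_const)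

theorem contDiff_gaugePow (hG : IsHType G g) (hX : IsHorizontalBasis G g X) {k : WithTop ℕ∞} :
    ContDiff ℝ k (gaugePow G g X) :=
  ((contDiff_horSq g X).pow 2).add
    (contDiff_const.mul (contDiff_inner g (contDiff_zPart hG hX) (contDiff_zPart hG hX)))

theorem contDiff_gaugeGrad (hG : IsHType G g) (hX : IsHorizontalBasis G g X) {k : WithTop ℕ∞}
    (i : Fin m) : ContDiff ℝ k fun x => gaugeGrad G g X x i := by
  have h1 : ContDiff ℝ k fun x => bracketL G x (X i) :=
    (bracketL G).contDiff.clm_apply contDiff_const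
  exact ((contDiff_const.mul (contDiff_horSq g X)).mul
    (contDiff_inner g contDiff_id contDiff_const)).add
    (contDiff_const.mul (contDiff_inner g (contDiff_zPart hG hX) h1))

theorem hasFDerivAt_inner_const (g : LinearMap.BilinForm ℝ (Pt m n)) (x w : Pt m n) :
    HasFDerivAt (fun y => g y w) ((innerL g).flip w) x := ((innerL g).flip w).hasFDerivAt

theorem inner_leftInv (hG : IsHType G g) (hX : IsHorizontalBasis G g X) (x : Pt m n)
    (i j : Fin m) : g (leftInv G (X i) x) (X j) = if i = j then 1 else 0 := by
  rw [leftInv_eq, map_add, LinearMap.add_apply,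
    hX.inner_left_eq_zero hG (z := twist G x (X i)) (by simp [twist_apply]), add_zero,
    hX.orthonormal]

theorem hasFDerivAt_horSq (hG : IsHType G g) (hX : IsHorizontalBasis G g X) (x : Pt m n) :
    ∃ L : Pt m n →L[ℝ] ℝ, HasFDerivAt (horSq g X) L x ∧
      ∀ i, L (leftInv G (X i) x) = 2 * g x (X i) := by
  refine ⟨_, HasFDerivAt.fun_sum fun j _ => (hasFDerivAt_inner_const g x (X j)).pow 2, fun i => ?_⟩
  simp [inner_leftInv hG hX]

/-- In the direction `X i + twist G x (X i)` the projection removes `X i`, and the quadratic term of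
Log subtracts half of `twist G x (X i) + twist G (X i) x`. What remains is half the bracket. -/
theorem hasFDerivAt_zPart (hG : IsHType G g) (hX : IsHorizontalBasis G g X) (x : Pt m n) :
    ∃ L : Pt m n →L[ℝ] Pt m n, HasFDerivAt (zPart G g X) L x ∧
      ∀ i, L (leftInv G (X i) x) = (1 / 2 : ℝ) • bracketL G x (X i) := by
  rw [funext (zPart_eq hG hX)]
  have h1 : HasFDerivAt (fun x => twist G x x) _ x :=
    (twist G).hasFDerivAt_of_bilinear (hasFDerivAt_id x) (hasFDerivAt_id x)
  refine ⟨_, ((hasFDerivAt_id x).fun_sub (h1.fun_const_smul (1 / 2 : ℝ))).fun_sub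
    (HasFDerivAt.fun_sum fun j _ => (hasFDerivAt_inner_const g x (X j)).smul_const (X j)),
    fun i => ?_⟩
  simp only [sub_apply, sum_apply, ContinuousLinearMap.smulRight_apply,
    ContinuousLinearMap.flip_apply, LinearMap.toContinuousBilinearMap_apply, inner_leftInv hG hX]
  simp only [leftInv_eq, bracketL_apply]
  simp [twist_twist_left, twist_twist_right]
  module

theorem along_eq {f : Pt m n → ℝ} {L : Pt m n →L[ℝ] ℝ} {x : Pt m n} (h : HasFDerivAt f L x)
    (w : Pt m n) : along G w f x = L (leftInv G w x) := by
  rw [along, h.fderiv]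

theorem along_gaugePow (hG : IsHType G g) (hX : IsHorizontalBasis G g X) (j : Fin m)
    (x : Pt m n) : along G (X j) (gaugePow G g X) x = gaugeGrad G g X x j := by
  obtain ⟨L, hL, hLi⟩ := hasFDerivAt_horSq hG hX x
  obtain ⟨Z, hZ, hZi⟩ := hasFDerivAt_zPart hG hX x
  obtain ⟨M, hM, hMi⟩ := hasFDerivAt_inner (g := g) hZ hZ
  have h : HasFDerivAt (gaugePow G g X) _ x := (hL.pow 2).fun_add (hM.const_mul 16)
  rw [along_eq h, gaugeGrad]
  simp only [add_apply, smul_apply, hLi, hMi, hZi, map_smul, LinearMap.smul_apply, smul_eq_mul]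
  rw [hG.symm (bracketL G x (X j))]
  simp
  ring

theorem along_gaugeGrad (hG : IsHType G g) (hX : IsHorizontalBasis G g X) (i j : Fin m)
    (x : Pt m n) : along G (X i) (fun x => gaugeGrad G g X x j) x = gaugeHess G g X x i j := by
  obtain ⟨L, hL, hLi⟩ := hasFDerivAt_horSq hG hX x
  obtain ⟨Z, hZ, hZi⟩ := hasFDerivAt_zPart hG hX x
  have hb : HasFDerivAt (fun x => bracketL G x (X j)) ((bracketL G).flip (X j)) x :=
    ((bracketL G).flip (X j)).hasFDerivAt
  obtain ⟨M, hM, hMi⟩ := hasFDerivAt_inner (g := g) hZ hb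
  have h : HasFDerivAt (fun x => gaugeGrad G g X x j) _ x :=
    ((hL.const_mul 4).fun_mul (hasFDerivAt_inner_const g x (X j))).fun_add (hM.const_mul 16)
  rw [along_eq h, gaugeHess]
  have hbr : bracketL G (leftInv G (X i) x) (X j) = bracketL G (X i) (X j) :=
    bracketL_congr G (by simp [leftInv_eq, twist_apply]) _
  simp only [add_apply, smul_apply, hLi, hMi, hZi, map_smul, LinearMap.smul_apply, smul_eq_mul,
    ContinuousLinearMap.flip_apply, LinearMap.toContinuousBilinearMap_apply, inner_leftInv hG hX,
    hbr]
  ring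

/-- The second horizontal derivatives of a function of the gauge. -/
theorem along_along_comp_gaugePow (hG : IsHType G g) (hX : IsHorizontalBasis G g X) {Ψ : ℝ → ℝ}
    (hΨ : ContDiff ℝ ∞ Ψ) (i j : Fin m) (x : Pt m n) :
    along G (X i) (along G (X j) fun y => Ψ (gaugePow G g X y)) x =
      deriv (deriv Ψ) (gaugePow G g X x) * (gaugeGrad G g X x i * gaugeGrad G g X x j)
        + deriv Ψ (gaugePow G g X x) * gaugeHess G g X x i j := by
  have hN : Differentiable ℝ (gaugePow G g X) :=
    (contDiff_gaugePow hG hX (k := 1)).differentiable (by simp)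
  have hD : Differentiable ℝ fun x => gaugeGrad G g X x j :=
    (contDiff_gaugeGrad hG hX (k := 1) j).differentiable (by simp)
  have hΨ' : ContDiff ℝ ∞ (deriv Ψ) := (contDiff_infty_iff_deriv.1 hΨ).2
  have comp : ∀ {Φ : ℝ → ℝ}, ContDiff ℝ ∞ Φ → ∀ x, HasFDerivAt (fun y => Φ (gaugePow G g X y))
      (deriv Φ (gaugePow G g X x) • fderiv ℝ (gaugePow G g X) x) x := fun hΦ x =>
    ((hΦ.differentiable (by simp)) _).hasDerivAt.comp_hasFDerivAt x (hN x).hasFDerivAt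
  have h1 : (along G (X j) fun y => Ψ (gaugePow G g X y)) =
      fun y => deriv Ψ (gaugePow G g X y) * gaugeGrad G g X y j := by
    funext y
    rw [along_eq (comp hΨ y), ← along_gaugePow hG hX]
    rfl
  rw [h1, along_eq ((comp hΨ' x).fun_mul (hD x).hasFDerivAt), ← along_gaugeGrad hG hX,
    ← along_gaugePow hG hX i]
  simp only [add_apply, smul_apply, smul_eq_mul, along]
  ring

theorem opL_comp_gaugePow (hG : IsHType G g) (hX : IsHorizontalBasis G g X) {Ψ : ℝ → ℝ}
    (hΨ : ContDiff ℝ ∞ Ψ) (A : Matrix (Fin m) (Fin m) ℝ) (x : Pt m n) :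
    ∑ i, ∑ j, A i j * along G (X i) (along G (X j) fun y => Ψ (gaugePow G g X y)) x =
      deriv (deriv Ψ) (gaugePow G g X x) * ((A *ᵥ gaugeGrad G g X x) ⬝ᵥ gaugeGrad G g X x)
        + deriv Ψ (gaugePow G g X x) * ∑ i, ∑ j, A i j * gaugeHess G g X x i j := by
  simp only [along_along_comp_gaugePow hG hX hΨ, quadForm_eq, Finset.mul_sum,
    ← Finset.sum_add_distrib]
  exact Finset.sum_congr rfl fun i _ => Finset.sum_congr rfl fun j _ => by ring

theorem contDiff_mul_left (G : HomogeneousLieGroup m n) (y : Pt m n) {k : WithTop ℕ∞} :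
    ContDiff ℝ k (G.mul y) := by
  rw [funext (mul_eq_twist G y)]
  exact (contDiff_const.add contDiff_id).add (twist G y).contDiff

/-- Left-invariant fields commute with left translations. -/
theorem along_comp_mul_left (w y : Pt m n) {f : Pt m n → ℝ} (hf : Differentiable ℝ f) :
    along G w (fun x => f (G.mul y x)) = fun x => along G w f (G.mul y x) := by
  funext x
  have h : HasFDerivAt (G.mul y) (ContinuousLinearMap.id ℝ (Pt m n) + twist G y) x := by
    rw [funext (mul_eq_twist G y)]
    exact ((hasFDerivAt_id x).const_add y).add (twist G y).hasFDerivAt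
  have h2 : HasFDerivAt (fun x => f (G.mul y x)) _ x := (hf _).hasFDerivAt.comp x h
  rw [along_eq h2, along]
  simp only [ContinuousLinearMap.comp_apply]
  congr 1
  simp only [leftInv_eq, mul_eq_twist, add_apply, ContinuousLinearMap.id_apply, map_add,
    twist_twist_left, twist_twist_right, add_zero]
  abel

theorem contDiff_along (G : HomogeneousLieGroup m n) (w : Pt m n) {f : Pt m n → ℝ}
    (hf : ContDiff ℝ ∞ f) : ContDiff ℝ ∞ (along G w f) := by
  have h : ContDiff ℝ ∞ (leftInv G w) := by
    rw [funext (leftInv_eq G w)]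
    exact contDiff_const.add ((twist G).flip w).contDiff
  exact (hf.fderiv_right (by simp)).clm_apply h

theorem inv_mul_rev (G : HomogeneousLieGroup m n) (x y : Pt m n) :
    G.inv (G.mul (G.inv x) y) = G.mul (G.inv y) x := by
  simp only [inv_eq_twist, mul_eq_twist, map_add, map_neg, add_apply, neg_apply, twist_twist_left,
    twist_twist_right, map_zero, zero_apply]
  abel

theorem inner_inv (hG : IsHType G g) (hX : IsHorizontalBasis G g X) (x : Pt m n) (j : Fin m) :
    g (G.inv x) (X j) = -g x (X j) := by
  rw [inv_eq_twist, map_add, LinearMap.add_apply,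
    hX.inner_left_eq_zero hG (z := twist G x x) (by simp [twist_apply])]
  simp

theorem horSq_inv (hG : IsHType G g) (hX : IsHorizontalBasis G g X) (x : Pt m n) :
    horSq g X (G.inv x) = horSq g X x := by
  simp [horSq, inner_inv hG hX]

theorem zPart_inv (hG : IsHType G g) (hX : IsHorizontalBasis G g X) (x : Pt m n) :
    zPart G g X (G.inv x) = -zPart G g X x := by
  simp only [zPart_eq hG hX, inner_inv hG hX]
  simp only [inv_eq_twist, map_add, map_neg, add_apply, neg_apply, twist_twist_left,
    twist_twist_right, neg_smul, Finset.sum_neg_distrib]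
  module

theorem gaugePow_inv (hG : IsHType G g) (hX : IsHorizontalBasis G g X) (x : Pt m n) :
    gaugePow G g X (G.inv x) = gaugePow G g X x := by
  simp [gaugePow, horSq_inv hG hX, zPart_inv hG hX]

/-- Inversion negates Log and so preserves the gauge. Exchanging the arguments makes the kernel a
left translate as a function of either variable: in ξ for invariance of the measure, in x for
invariance of the fields. -/
theorem gaugePow_inv_mul_comm (hG : IsHType G g) (hX : IsHorizontalBasis G g X) (x y : Pt m n) :
    gaugePow G g X (G.mul (G.inv x) y) = gaugePow G g X (G.mul (G.inv y) x) := by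
  rw [← inv_mul_rev, gaugePow_inv hG hX]

theorem horSq_inv_mul_comm (hG : IsHType G g) (hX : IsHorizontalBasis G g X) (x y : Pt m n) :
    horSq g X (G.mul (G.inv x) y) = horSq g X (G.mul (G.inv y) x) := by
  rw [← inv_mul_rev, horSq_inv hG hX]

end Calculus

/-! ### Invariance of Lebesgue measure under left translations -/

/-- Shears over translations preserve Lebesgue measure. -/
theorem measurePreserving_shear (c : Fin m → ℝ) {φ : (Fin m → ℝ) → (Fin n → ℝ)}
    (hφ : Continuous φ) :
    MeasurePreserving (fun p : Pt m n => (c + p.1, φ p.1 + p.2)) := by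
  rw [Measure.volume_eq_prod]
  refine (measurePreserving_add_left volume c).skew_product (g := fun a d => φ a + d) ?_ ?_
  · exact ((hφ.comp continuous_fst).add continuous_snd).measurable
  · exact Eventually.of_forall fun a => (measurePreserving_add_left volume (φ a)).map_eq

/-- Left translations as homeomorphisms. -/
def leftHomeo (G : HomogeneousLieGroup m n) (x : Pt m n) : Pt m n ≃ₜ Pt m n where
  toFun := G.mul x
  invFun := G.mul (G.inv x)
  left_inv y := by rw [← G.mul_assoc, G.inv_mul, G.zero_mul]
  right_inv y := by rw [← G.mul_assoc, G.mul_inv, G.zero_mul]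
  continuous_toFun := (contDiff_mul_left G x (k := 0)).continuous
  continuous_invFun := (contDiff_mul_left G _ (k := 0)).continuous

theorem measurePreserving_mul_left (G : HomogeneousLieGroup m n) (x : Pt m n) :
    MeasurePreserving (G.mul x) := by
  have h := measurePreserving_shear (n := n) x.1
    (φ := fun a => x.2 + cocycle G x.1 a) (by fun_prop)
  convert h using 2 with y
  rw [mul_eq, add_right_comm]

theorem measurableEmbedding_mul_left (G : HomogeneousLieGroup m n) (x : Pt m n) :
    MeasurableEmbedding (G.mul x) :=
  (leftHomeo G x).measurableEmbedding

theorem integral_comp_mul_left (G : HomogeneousLieGroup m n) (x : Pt m n) (f : Pt m n → ℝ) :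
    ∫ ξ, f (G.mul x ξ) = ∫ ξ, f ξ :=
  (measurePreserving_mul_left G x).integral_comp (measurableEmbedding_mul_left G x) f

/-- The constant is the minimum over the compact unit sphere, carried to all vectors by homogeneity;
the sphere is empty exactly when the space is trivial. -/
theorem exists_pos_mul_norm_sq_le {E : Type*} [NormedAddCommGroup E] [NormedSpace ℝ E]
    [FiniteDimensional ℝ E] {f : E → ℝ} (hf : Continuous f)
    (hhom : ∀ (r : ℝ) (x : E), f (r • x) = r ^ 2 * f x) (hpos : ∀ x, x ≠ 0 → 0 < f x) :
    ∃ κ : ℝ, 0 < κ ∧ ∀ x, κ * ‖x‖ ^ 2 ≤ f x := by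
  have h0 : f 0 = 0 := by simpa using hhom 0 0
  rcases (Metric.sphere (0 : E) 1).eq_empty_or_nonempty with he | hne
  · refine ⟨1, one_pos, fun x => ?_⟩
    have hx : x = 0 := by
      by_contra hx
      have : ‖x‖⁻¹ • x ∈ Metric.sphere (0 : E) 1 := by
        simp [norm_smul, inv_mul_cancel₀ (norm_ne_zero_iff.2 hx)]
      rw [he] at this
      exact this
    simp [hx, h0]
  · have : ProperSpace E := FiniteDimensional.proper ℝ E
    obtain ⟨u, hu, hmin⟩ := (isCompact_sphere (0 : E) 1).exists_isMinOn hne hf.continuousOn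
    have hu0 : u ≠ 0 := fun h => by simp [h] at hu
    refine ⟨f u, hpos u hu0, fun x => ?_⟩
    rcases eq_or_ne x 0 with rfl | hx
    · simp [h0]
    have hmem : ‖x‖⁻¹ • x ∈ Metric.sphere (0 : E) 1 := by
      simp [norm_smul, inv_mul_cancel₀ (norm_ne_zero_iff.2 hx)]
    have h1 : f u ≤ f (‖x‖⁻¹ • x) := hmin hmem
    rw [hhom] at h1
    have hn : 0 < ‖x‖ := norm_pos_iff.2 hx
    calc f u * ‖x‖ ^ 2 ≤ ‖x‖⁻¹ ^ 2 * f x * ‖x‖ ^ 2 := mul_le_mul_of_nonneg_right h1 (sq_nonneg _)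
      _ = f x := by field_simp

/-! ### Gauge balls: adapted coordinates, compactness, volume and dilations -/

section Gauge

variable {G : HomogeneousLieGroup m n} {g : LinearMap.BilinForm ℝ (Pt m n)} {X : Fin m → Pt m n}

/-- The vertical offset of the logarithm over the first layer. -/
def vertShift (G : HomogeneousLieGroup m n) (g : LinearMap.BilinForm ℝ (Pt m n))
    (X : Fin m → Pt m n) (a : Fin m → ℝ) : Fin n → ℝ := (zPart G g X (a, 0)).2

theorem continuous_vertShift (hG : IsHType G g) (hX : IsHorizontalBasis G g X) :
    Continuous (vertShift G g X) :=
  continuous_snd.comp ((contDiff_zPart hG hX (k := 0)).continuous.comp (by fun_prop))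

/-- The gauge in coordinates adapted to the splitting of the Lie algebra. -/
def splitPow (g : LinearMap.BilinForm ℝ (Pt m n)) (X : Fin m → Pt m n) (p : Pt m n) : ℝ :=
  horSq g X (p.1, 0) ^ 2 + 16 * g (0, p.2) (0, p.2)

theorem inner_basis_fst (hG : IsHType G g) (hX : IsHorizontalBasis G g X) (x : Pt m n)
    (j : Fin m) : g x (X j) = g (x.1, 0) (X j) := by
  have h := hX.inner_left_eq_zero hG (z := x - (x.1, 0)) (by simp) j
  rwa [map_sub, LinearMap.sub_apply, sub_eq_zero] at h

theorem horSq_fst (hG : IsHType G g) (hX : IsHorizontalBasis G g X) (x : Pt m n) :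
    horSq g X x = horSq g X (x.1, 0) := by
  simp only [horSq, ← inner_basis_fst hG hX x]

theorem zPart_split (hG : IsHType G g) (hX : IsHorizontalBasis G g X) (x : Pt m n) :
    zPart G g X x = (0, vertShift G g X x.1 + x.2) := by
  refine Prod.ext (zPart_fst hG hX x) ?_
  simp only [vertShift, zPart_eq hG hX, ← inner_basis_fst hG hX x, twist_apply]
  simp only [Prod.snd_sub, Prod.smul_snd]
  abel

/-- The change of coordinates to the splitting of the Lie algebra. -/
def split (G : HomogeneousLieGroup m n) (g : LinearMap.BilinForm ℝ (Pt m n))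
    (X : Fin m → Pt m n) (x : Pt m n) : Pt m n := (0 + x.1, vertShift G g X x.1 + x.2)

/-- The inverse of `split`. -/
def unsplit (G : HomogeneousLieGroup m n) (g : LinearMap.BilinForm ℝ (Pt m n))
    (X : Fin m → Pt m n) (x : Pt m n) : Pt m n := (x.1, x.2 - vertShift G g X x.1)

theorem unsplit_split (x : Pt m n) : unsplit G g X (split G g X x) = x := by
  ext <;> simp [unsplit, split]

theorem split_unsplit (x : Pt m n) : split G g X (unsplit G g X x) = x := by
  ext <;> simp [unsplit, split]

theorem continuous_unsplit (hG : IsHType G g) (hX : IsHorizontalBasis G g X) :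
    Continuous (unsplit G g X) :=
  continuous_fst.prodMk (continuous_snd.sub ((continuous_vertShift hG hX).comp continuous_fst))

theorem measurePreserving_split (hG : IsHType G g) (hX : IsHorizontalBasis G g X) :
    MeasurePreserving (split G g X) :=
  measurePreserving_shear 0 (continuous_vertShift hG hX)

/-- The horizontal space may be tilted against the first layer, and then the gauge need not be
homogeneous for the dilations of the group. It is homogeneous after this volume-preserving shear,
which is all that scaling arguments need. -/
theorem gaugePow_eq_splitPow (hG : IsHType G g) (hX : IsHorizontalBasis G g X) (x : Pt m n) :
    gaugePow G g X x = splitPow g X (split G g X x) := by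
  rw [gaugePow, splitPow, zPart_split hG hX, horSq_fst hG hX]
  simp [split]

theorem splitPow_dil (r : ℝ) (p : Pt m n) : splitPow g X (dil r p) = r ^ 4 * splitPow g X p := by
  have h1 : (((dil r p).1, 0) : Pt m n) = r • (p.1, 0) := by simp [dil]
  have h2 : ((0, (dil r p).2) : Pt m n) = r ^ 2 • (0, p.2) := by simp [dil]
  rw [splitPow, h1, h2, splitPow]
  simp only [horSq, map_smul, LinearMap.smul_apply, smul_eq_mul, mul_pow, ← Finset.mul_sum]
  ring

theorem continuous_splitPow : Continuous (splitPow g X) := by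
  have h1 : Continuous fun p : Pt m n => horSq g X (p.1, 0) :=
    (contDiff_horSq g X (k := 0)).continuous.comp (by fun_prop)
  have h2 : ContDiff ℝ 0 fun p : Pt m n => g (0, p.2) (0, p.2) :=
    contDiff_inner g (contDiff_const.prodMk contDiff_snd) (contDiff_const.prodMk contDiff_snd)
  exact (h1.pow 2).add (continuous_const.mul h2.continuous)

theorem horSq_pos (hG : IsHType G g) (hX : IsHorizontalBasis G g X) {a : Fin m → ℝ} (ha : a ≠ 0) :
    0 < horSq g X (a, 0) := by
  refine lt_of_le_of_ne (horSq_nonneg _) fun h => ha ?_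
  have hj : ∀ j, g (a, 0) (X j) = 0 := fun j => by
    have := (Finset.sum_eq_zero_iff_of_nonneg (fun j _ => sq_nonneg (g (a, 0) (X j)))).1 h.symm j
      (Finset.mem_univ j)
    exact pow_eq_zero_iff (two_ne_zero) |>.1 this
  have := hX.sub_proj_fst hG (a, 0)
  simpa [hj] using this

theorem isCompact_splitPow_le (hG : IsHType G g) (hX : IsHorizontalBasis G g X) (c : ℝ) :
    IsCompact {p : Pt m n | splitPow g X p ≤ c} := by
  obtain ⟨κ, hκ, h1⟩ := exists_pos_mul_norm_sq_le (E := Fin m → ℝ)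
    (f := fun a => horSq g X (a, 0))
    ((contDiff_horSq g X (k := 0)).continuous.comp (by fun_prop))
    (fun r a => by
      have : ((r • a, 0) : Pt m n) = r • (a, 0) := by simp
      simp only [this, horSq, map_smul, LinearMap.smul_apply, smul_eq_mul, mul_pow,
        ← Finset.mul_sum])
    (fun a ha => horSq_pos hG hX ha)
  obtain ⟨μ, hμ, h2⟩ := exists_pos_mul_norm_sq_le (E := Fin n → ℝ)
    (f := fun d => g ((0, d) : Pt m n) (0, d))
    (contDiff_inner (k := 0) g (contDiff_const.prodMk contDiff_id)
      (contDiff_const.prodMk contDiff_id)).continuous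
    (fun r d => by
      have : ((0, r • d) : Pt m n) = r • (0, d) := by simp
      simp only [this, map_smul, LinearMap.smul_apply, smul_eq_mul]
      ring)
    (fun d hd => hG.pos _ fun h => hd (congrArg Prod.snd h))
  refine Metric.isCompact_of_isClosed_isBounded
    (isClosed_le continuous_splitPow continuous_const) ?_
  refine (Metric.isBounded_closedBall (x := (0 : Pt m n))
    (r := max (Real.sqrt (Real.sqrt c / κ)) (Real.sqrt (c / 16 / μ)))).subset fun p hp => ?_
  have hp' : horSq g X (p.1, 0) ^ 2 + 16 * g (0, p.2) (0, p.2) ≤ c := hp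
  rw [mem_closedBall_zero_iff]
  refine max_le_max ?_ ?_
  · refine Real.le_sqrt_of_sq_le ((le_div_iff₀' hκ).2 ((h1 p.1).trans ?_))
    refine Real.le_sqrt_of_sq_le ?_
    have := hG.nonneg ((0, p.2) : Pt m n)
    linarith
  · refine Real.le_sqrt_of_sq_le ((le_div_iff₀' hμ).2 ((h2 p.2).trans ?_))
    have := sq_nonneg (horSq g X (p.1, 0))
    linarith

theorem isCompact_gaugePow_le (hG : IsHType G g) (hX : IsHorizontalBasis G g X) (c : ℝ) :
    IsCompact {x : Pt m n | gaugePow G g X x ≤ c} := by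
  refine ((isCompact_splitPow_le hG hX c).image (continuous_unsplit hG hX)).of_isClosed_subset
    (isClosed_le (contDiff_gaugePow hG hX (k := 0)).continuous continuous_const) fun x hx => ?_
  exact ⟨split G g X x, by rwa [mem_ofPred_eq, ← gaugePow_eq_splitPow hG hX], unsplit_split x⟩

/-- The larger sublevel set is the preimage of the smaller under the linear dilation by r⁻¹, whose
determinant is r^(-Q). -/
theorem volume_splitPow_le (p : ℝ) {r : ℝ} (hr : 0 < r) :
    volume {x : Pt m n | splitPow g X x ≤ r ^ 4 * p} =
      ENNReal.ofReal (r ^ (m + 2 * n)) * volume {x : Pt m n | splitPow g X x ≤ p} := by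
  let D : Pt m n →ₗ[ℝ] Pt m n :=
    (r⁻¹ • LinearMap.id).prodMap ((r⁻¹ ^ 2) • LinearMap.id)
  have hD : ∀ x, D x = dil r⁻¹ x := fun x => rfl
  have hdet : LinearMap.det D = (r ^ (m + 2 * n))⁻¹ := by
    rw [LinearMap.det_prodMap, LinearMap.det_smul, LinearMap.det_smul]
    simp only [LinearMap.det_id, mul_one, Module.finrank_fin_fun]
    rw [← pow_mul, ← pow_add, inv_pow]
  have : (volume : Measure (Pt m n)).IsAddHaarMeasure := by
    rw [Measure.volume_eq_prod]; exact Measure.prod.instIsAddHaarMeasure volume volume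
  have h := Measure.addHaar_preimage_linearMap (volume : Measure (Pt m n)) (f := D)
    (by rw [hdet]; positivity) {x : Pt m n | splitPow g X x ≤ p}
  rw [hdet, inv_inv, abs_of_pos (by positivity)] at h
  rw [← h]
  congr 1
  ext x
  simp only [mem_ofPred_eq, mem_preimage, hD, splitPow_dil]
  rw [inv_pow, inv_mul_le_iff₀ (by positivity)]

theorem volume_gaugePow_le (hG : IsHType G g) (hX : IsHorizontalBasis G g X) {r : ℝ}
    (hr : 0 < r) : volume {x : Pt m n | gaugePow G g X x ≤ r ^ 4} =
      ENNReal.ofReal (r ^ (m + 2 * n)) * volume {x : Pt m n | gaugePow G g X x ≤ 1} := by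
  have h : ∀ c, volume {x : Pt m n | gaugePow G g X x ≤ c} =
      volume {x : Pt m n | splitPow g X x ≤ c} := by
    intro c
    rw [← (measurePreserving_split hG hX).measure_preimage
      (isClosed_le continuous_splitPow continuous_const).measurableSet.nullMeasurableSet]
    simp only [gaugePow_eq_splitPow hG hX, preimage_ofPred_eq]
  rw [h, h, ← volume_splitPow_le 1 hr, mul_one]

/-- The dilations adapted to the splitting of the Lie algebra. -/
def splitDil (G : HomogeneousLieGroup m n) (g : LinearMap.BilinForm ℝ (Pt m n))
    (X : Fin m → Pt m n) (r : ℝ) (x : Pt m n) : Pt m n := unsplit G g X (dil r (split G g X x))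

theorem gaugePow_splitDil (hG : IsHType G g) (hX : IsHorizontalBasis G g X) (r : ℝ) (x : Pt m n) :
    gaugePow G g X (splitDil G g X r x) = r ^ 4 * gaugePow G g X x := by
  rw [gaugePow_eq_splitPow hG hX, splitDil, split_unsplit, splitPow_dil,
    ← gaugePow_eq_splitPow hG hX]

theorem splitDil_one (x : Pt m n) : splitDil G g X 1 x = x := by
  have : dil 1 (split G g X x) = split G g X x := by simp [dil]
  rw [splitDil, this, unsplit_split]

theorem splitDil_zero (hG : IsHType G g) (hX : IsHorizontalBasis G g X) (x : Pt m n) :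
    splitDil G g X 0 x = 0 := by
  have h1 : zPart G g X (0 : Pt m n) = 0 := by simp [zPart_eq hG hX]
  have h2 : vertShift G g X 0 = 0 := by
    have : ((0, 0) : Pt m n) = 0 := rfl
    rw [vertShift, this, h1]; rfl
  simp [splitDil, unsplit, dil, h2]

theorem continuous_splitDil (hG : IsHType G g) (hX : IsHorizontalBasis G g X) (x : Pt m n) :
    Continuous fun r : ℝ => splitDil G g X r x :=
  (continuous_unsplit hG hX).comp (by unfold dil; fun_prop)

theorem gaugePow_eq_gaugeNorm_pow (hG : IsHType G g) (hX : IsHorizontalBasis G g X) (x : Pt m n) :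
    gaugePow G g X x = gaugeNorm G g X x ^ 4 := by
  rw [gaugeNorm_eq hG hX, ← Real.rpow_natCast, ← Real.rpow_mul (gaugePow_nonneg hG x)]
  norm_num

theorem gaugeNorm_nonneg (hG : IsHType G g) (hX : IsHorizontalBasis G g X) (x : Pt m n) :
    0 ≤ gaugeNorm G g X x := by
  rw [gaugeNorm_eq hG hX]; exact Real.rpow_nonneg (gaugePow_nonneg hG x) _

/-- A gauge ball around `x` that is closer to `x` than the boundary of `O` is contained in `O`. -/
theorem mul_mem_of_lt_gaugeDist (hG : IsHType G g) (hX : IsHorizontalBasis G g X)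
    {O O' : Set (Pt m n)} (hO : IsOpen O) (hO' : O' ⊆ O) {R : ℝ}
    (hR : R < gaugeDist G g X O' (frontier O)) {x : Pt m n} (hx : x ∈ O') {y : Pt m n}
    (hy : gaugeNorm G g X y ≤ R) : G.mul x y ∈ O := by
  by_contra hmem
  let c : ℝ → Pt m n := fun t => G.mul x (splitDil G g X t y)
  have hc : Continuous c :=
    (contDiff_mul_left G x (k := 0)).continuous.comp (continuous_splitDil hG hX y)
  have hpre : IsPreconnected (c '' Icc 0 1) := isPreconnected_Icc.image c hc.continuousOn
  have hc0 : c 0 = x := by simp [c, splitDil_zero hG hX, G.mul_zero]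
  have hc1 : c 1 = G.mul x y := by simp [c, splitDil_one]
  -- The curve joins a point of `O` to a point outside it, so by connectedness it meets the
  -- boundary. Along it the gauge distance from `x` is at most that of the endpoint, which
  -- contradicts the distance hypothesis.
  have hfr : ∃ t ∈ Icc (0 : ℝ) 1, c t ∈ frontier O := by
    by_contra hno
    push Not at hno
    have hsub : c '' Icc 0 1 ⊆ O ∪ (closure O)ᶜ := by
      rintro _ ⟨t, ht, rfl⟩
      by_contra h
      simp only [mem_union, mem_compl_iff, not_or, not_not] at h
      refine hno t ht ?_
      rw [hO.frontier_eq]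
      exact ⟨h.2, h.1⟩
    have := hpre.subset_left_of_subset_union hO isClosed_closure.isOpen_compl
      (disjoint_compl_right.mono_left subset_closure) hsub
      ⟨x, ⟨0, by simp, hc0⟩, hO' hx⟩
    exact hmem (hc1 ▸ this ⟨1, by simp, rfl⟩)
  obtain ⟨t, ht, hξ⟩ := hfr
  have hle : gaugeDist G g X O' (frontier O) ≤ gaugeNorm G g X (G.mul (G.inv (c t)) x) := by
    refine csInf_le ⟨0, ?_⟩ ⟨x, hx, c t, hξ, rfl⟩
    rintro r ⟨x', -, ξ, -, rfl⟩
    exact gaugeNorm_nonneg hG hX _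
  have h1 : gaugePow G g X (G.mul (G.inv (c t)) x) = t ^ 4 * gaugePow G g X y := by
    rw [gaugePow_inv_mul_comm hG hX]
    simp only [c]
    rw [← G.mul_assoc, G.inv_mul, G.zero_mul, gaugePow_splitDil hG hX]
  have h2 : gaugeNorm G g X (G.mul (G.inv (c t)) x) ≤ gaugeNorm G g X y := by
    rw [gaugeNorm_eq hG hX, gaugeNorm_eq hG hX, h1]
    refine Real.rpow_le_rpow (mul_nonneg (pow_nonneg ht.1 4) (gaugePow_nonneg hG y)) ?_ (by norm_num)
    exact mul_le_of_le_one_left (gaugePow_nonneg hG y) (pow_le_one₀ ht.1 ht.2)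
  linarith

end Gauge

/-! ### Integrability of the kernel and uniform convergence -/

section Integrability

variable {G : HomogeneousLieGroup m n} {g : LinearMap.BilinForm ℝ (Pt m n)} {X : Fin m → Pt m n}

theorem gaugeNorm_rpow (hG : IsHType G g) (hX : IsHorizontalBasis G g X) (α : ℝ) (x : Pt m n) :
    gaugeNorm G g X x ^ (-α) = gaugePow G g X x ^ (-(α / 4)) := by
  rw [gaugeNorm_eq hG hX, ← Real.rpow_mul (gaugePow_nonneg hG x)]
  congr 1; ring

theorem measurable_gaugePow_rpow (hG : IsHType G g) (hX : IsHorizontalBasis G g X) (c : ℝ) :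
    Measurable fun x => gaugePow G g X x ^ c :=
  (contDiff_gaugePow hG hX (k := 0)).continuous.measurable.pow_const c

theorem measurableSet_gaugePow_le (hG : IsHType G g) (hX : IsHorizontalBasis G g X) (c : ℝ) :
    MeasurableSet {x : Pt m n | gaugePow G g X x ≤ c} :=
  (isClosed_le (contDiff_gaugePow hG hX (k := 0)).continuous continuous_const).measurableSet

/-- Negative powers of the gauge of order below the homogeneous dimension are integrable at the
origin. -/
theorem integrableOn_gaugePow_rpow (hG : IsHType G g) (hX : IsHorizontalBasis G g X) {α : ℝ}
    (hα : 0 < α) (hαQ : α < homDim m n) :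
    IntegrableOn (fun x => gaugePow G g X x ^ (-(α / 4))) {x | gaugePow G g X x ≤ 1} := by
  refine ⟨(measurable_gaugePow_rpow hG hX _).aestronglyMeasurable, ?_⟩
  set B : ℕ → Set (Pt m n) := fun k => {x | gaugePow G g X x ≤ ((1 / 2 : ℝ) ^ k) ^ 4} with hB
  set V := volume {x : Pt m n | gaugePow G g X x ≤ 1} with hV
  have hVfin : V ≠ ⊤ := (isCompact_gaugePow_le hG hX 1).measure_lt_top.ne
  have hvol : ∀ k, volume (B k) = ENNReal.ofReal (((1 / 2 : ℝ) ^ k) ^ (m + 2 * n)) * V :=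
    fun k => volume_gaugePow_le hG hX (by positivity)
  -- On the shell 2^(-(k+1)) < d ≤ 2^(-k) the kernel is at most `a k`. Using whole balls `B k` in
  -- place of shells costs nothing: the series is geometric with ratio 2^(α - Q) < 1.
  set a : ℕ → ℝ := fun k => ((1 / 2 : ℝ) ^ (k + 1)) ^ (-α) with ha
  have hptw : ∀ x ∈ {x | gaugePow G g X x ≤ 1}, ‖gaugePow G g X x ^ (-(α / 4))‖ₑ ≤
      ∑' k, (B k).indicator (fun _ => ENNReal.ofReal (a k)) x := by
    intro x hx
    have hx1 : gaugePow G g X x ≤ 1 := hx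
    rcases (gaugePow_nonneg hG x (X := X)).eq_or_lt with h0 | h0
    -- At the pole the real power of zero with nonzero exponent is zero by convention, so the bound
    -- is trivial there.
    · rw [← h0, Real.zero_rpow (by linarith)]; simp
    obtain ⟨k, hk1, hk2⟩ := exists_nat_pow_near_of_lt_one h0 hx1
      (by norm_num : (0 : ℝ) < (1 / 2) ^ 4) (by norm_num)
    rw [← pow_mul, mul_comm, pow_mul] at hk1 hk2
    refine le_trans ?_ (ENNReal.le_tsum k)
    rw [indicator_of_mem (show x ∈ B k from hk2), Real.enorm_eq_ofReal (Real.rpow_nonneg h0.le _)]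
    refine ENNReal.ofReal_le_ofReal ?_
    have h1 : a k = (((1 / 2 : ℝ) ^ (k + 1)) ^ 4) ^ (-(α / 4)) := by
      simp only [ha]
      rw [← Real.rpow_natCast _ 4, ← Real.rpow_mul (by positivity)]
      congr 1; push_cast; ring
    rw [h1]
    exact Real.rpow_le_rpow_of_nonpos (by positivity) hk1.le (by linarith)
  have hsum : Summable fun k => a k * ((1 / 2 : ℝ) ^ k) ^ (m + 2 * n) := by
    have hterm : ∀ k, a k * ((1 / 2 : ℝ) ^ k) ^ (m + 2 * n) =
        (1 / 2 : ℝ) ^ (-α) * ((1 / 2 : ℝ) ^ (homDim m n - α)) ^ k := by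
      intro k
      have h2 : (0 : ℝ) < 1 / 2 := by norm_num
      simp only [ha]
      rw [← Real.rpow_natCast (_ ^ k), ← Real.rpow_natCast _ k, ← Real.rpow_natCast _ (k + 1),
        ← Real.rpow_natCast (_ ^ (homDim m n - α)), ← Real.rpow_mul h2.le, ← Real.rpow_mul h2.le,
        ← Real.rpow_mul h2.le, ← Real.rpow_add h2, ← Real.rpow_add h2]
      congr 1
      unfold homDim; push_cast; ring
    simp only [hterm]
    refine (summable_geometric_of_lt_one (by positivity) ?_).mul_left _
    exact Real.rpow_lt_one (by norm_num) (by norm_num) (by linarith)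
  calc ∫⁻ x in {x | gaugePow G g X x ≤ 1}, ‖gaugePow G g X x ^ (-(α / 4))‖ₑ
      ≤ ∫⁻ x in {x | gaugePow G g X x ≤ 1}, ∑' k, (B k).indicator (fun _ => ENNReal.ofReal (a k)) x :=
        setLIntegral_mono' (measurableSet_gaugePow_le hG hX 1) hptw
    _ ≤ ∫⁻ x, ∑' k, (B k).indicator (fun _ => ENNReal.ofReal (a k)) x := setLIntegral_le_lintegral _ _
    _ = ∑' k, ENNReal.ofReal (a k) * volume (B k) := by
        rw [lintegral_tsum fun k =>
          (measurable_const.indicator (measurableSet_gaugePow_le hG hX _)).aemeasurable]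
        exact tsum_congr fun k => lintegral_indicator_const (measurableSet_gaugePow_le hG hX _) _
    _ = (∑' k, ENNReal.ofReal (a k * ((1 / 2 : ℝ) ^ k) ^ (m + 2 * n))) * V := by
        rw [← ENNReal.tsum_mul_right]
        refine tsum_congr fun k => ?_
        rw [hvol, ← mul_assoc, ← ENNReal.ofReal_mul (by positivity)]
    _ < ⊤ := ENNReal.mul_lt_top hsum.tsum_ofReal_lt_top hVfin.lt_top

/-- The singular part of the kernel, truncated to a gauge ball. -/
def truncPow (G : HomogeneousLieGroup m n) (g : LinearMap.BilinForm ℝ (Pt m n))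
    (X : Fin m → Pt m n) (α c : ℝ) : Pt m n → ℝ :=
  {x | gaugePow G g X x ≤ c}.indicator fun x => gaugePow G g X x ^ (-(α / 4))

theorem integrable_truncPow_one (hG : IsHType G g) (hX : IsHorizontalBasis G g X) {α : ℝ}
    (hα : 0 < α) (hαQ : α < homDim m n) : Integrable (truncPow G g X α 1) :=
  (integrable_indicator_iff (measurableSet_gaugePow_le hG hX 1)).2
    (integrableOn_gaugePow_rpow hG hX hα hαQ)

theorem truncPow_nonneg (hG : IsHType G g) (α c : ℝ) (x : Pt m n) :
    0 ≤ truncPow G g X α c x :=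
  indicator_nonneg (fun x _ => Real.rpow_nonneg (gaugePow_nonneg hG x) _) x

theorem truncPow_mono (hG : IsHType G g) (α : ℝ) {c c' : ℝ} (h : c ≤ c') (x : Pt m n) :
    truncPow G g X α c x ≤ truncPow G g X α c' x :=
  indicator_le_indicator_of_subset (fun _ hx => le_trans hx h)
    (fun x => Real.rpow_nonneg (gaugePow_nonneg hG x) _) x

theorem measurable_truncPow (hG : IsHType G g) (hX : IsHorizontalBasis G g X) (α c : ℝ) :
    Measurable (truncPow G g X α c) :=
  (measurable_gaugePow_rpow hG hX _).indicator (measurableSet_gaugePow_le hG hX c)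

theorem gaugePow_rpow_le (hG : IsHType G g) {α : ℝ} (hα : 0 < α) (x : Pt m n) :
    gaugePow G g X x ^ (-(α / 4)) ≤ truncPow G g X α 1 x + 1 := by
  by_cases hx : gaugePow G g X x ≤ 1
  · rw [truncPow, indicator_of_mem (show x ∈ {x | gaugePow G g X x ≤ 1} from hx)]
    linarith
  · push Not at hx
    have := Real.rpow_le_one_of_one_le_of_nonpos hx.le (by linarith : -(α / 4) ≤ 0)
    have := truncPow_nonneg (X := X) hG α 1 x
    linarith

theorem kernel_eq (hG : IsHType G g) (hX : IsHorizontalBasis G g X) (α : ℝ) (x ξ : Pt m n) :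
    kernel G g X α x ξ = gaugePow G g X (G.mul (G.inv x) ξ) ^ (-(α / 4)) :=
  gaugeNorm_rpow hG hX α _

theorem integrableOn_kernel (hG : IsHType G g) (hX : IsHorizontalBasis G g X) {α : ℝ}
    (hα : 0 < α) (hαQ : α < homDim m n) {O : Set (Pt m n)} (hO : volume O ≠ ⊤) (x : Pt m n) :
    IntegrableOn (kernel G g X α x) O := by
  have hmul : Measurable (G.mul (G.inv x)) := (measurePreserving_mul_left G _).measurable
  have hint : IntegrableOn (fun ξ => truncPow G g X α 1 (G.mul (G.inv x) ξ) + 1) O :=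
    (((measurePreserving_mul_left G (G.inv x)).integrable_comp_of_integrable
      (integrable_truncPow_one hG hX hα hαQ)).integrableOn).add (integrableOn_const hO)
  refine hint.mono' ?_ (Eventually.of_forall fun ξ => ?_)
  · have : Measurable (kernel G g X α x) := by
      rw [funext (kernel_eq hG hX α x)]
      exact (measurable_gaugePow_rpow hG hX _).comp hmul
    exact this.aestronglyMeasurable
  · rw [kernel_eq hG hX, Real.norm_of_nonneg (Real.rpow_nonneg (gaugePow_nonneg hG _) _)]
    exact gaugePow_rpow_le hG hα _

/-- Dominated convergence: the truncation eventually vanishes at each point where the gauge is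
positive, and at the pole its value is zero by convention. -/
theorem tendsto_integral_truncPow (hG : IsHType G g) (hX : IsHorizontalBasis G g X) {α : ℝ}
    (hα : 0 < α) (hαQ : α < homDim m n) :
    Tendsto (fun ε : ℝ => ∫ y, truncPow G g X α ((2 * ε) ^ 4) y) (𝓝[>] 0) (𝓝 0) := by
  have hsmall : ∀ c : ℝ, 0 < c → ∀ᶠ ε : ℝ in 𝓝[>] 0, (2 * ε) ^ 4 < c := by
    intro c hc
    have : Tendsto (fun ε : ℝ => (2 * ε) ^ 4) (𝓝[>] 0) (𝓝 0) := by
      have h : Continuous fun ε : ℝ => (2 * ε) ^ 4 := by fun_prop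
      simpa using (h.tendsto 0).mono_left (nhdsWithin_le_nhds (s := Ioi (0 : ℝ)))
    exact this.eventually_lt_const hc
  rw [show 𝓝 (0 : ℝ) = 𝓝 (∫ _ : Pt m n, (0 : ℝ)) by simp]
  refine tendsto_integral_filter_of_dominated_convergence (truncPow G g X α 1) ?_ ?_
    (integrable_truncPow_one hG hX hα hαQ) (Eventually.of_forall fun y => ?_)
  · exact Eventually.of_forall fun ε => (measurable_truncPow hG hX α _).aestronglyMeasurable
  · filter_upwards [hsmall 1 one_pos] with ε hε
    refine Eventually.of_forall fun y => ?_
    rw [Real.norm_of_nonneg (truncPow_nonneg hG _ _ _)]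
    exact truncPow_mono hG α hε.le y
  · rcases (gaugePow_nonneg hG y (X := X)).eq_or_lt with h | h
    · have : ∀ c, truncPow G g X α c y = 0 := by
        intro c
        refine indicator_apply_eq_zero.2 fun _ => ?_
        simp only [← h]
        rw [Real.zero_rpow (by linarith)]
      simp [this]
    · refine tendsto_const_nhds.congr' ?_
      filter_upwards [hsmall _ h] with ε hε
      have hm : y ∉ {x | gaugePow G g X x ≤ (2 * ε) ^ 4} := not_le.2 hε
      rw [truncPow, indicator_of_notMem hm]

/-- The cut-off matters only where d < 2ε, and there |η - 1| ≤ 1. -/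
theorem IsCutoff.abs_sub_le (hG : IsHType G g) (hX : IsHorizontalBasis G g X) {α ε : ℝ}
    {η : ℝ → ℝ} (hη : IsCutoff ε η) (x ξ : Pt m n) :
    |cutKernel G g X α η x ξ - kernel G g X α x ξ| ≤
      truncPow G g X α ((2 * ε) ^ 4) (G.mul (G.inv x) ξ) := by
  have hd := gaugeNorm_nonneg hG hX (G.mul (G.inv x) ξ)
  rw [cutKernel]
  have hk : 0 ≤ kernel G g X α x ξ := Real.rpow_nonneg hd _
  by_cases h : 2 * ε ≤ gaugeNorm G g X (G.mul (G.inv x) ξ)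
  · rw [hη.eq_one _ h]
    simpa using truncPow_nonneg hG α _ _
  · push Not at h
    have hmem : G.mul (G.inv x) ξ ∈ {y | gaugePow G g X y ≤ (2 * ε) ^ 4} := by
      rw [mem_ofPred_eq, gaugePow_eq_gaugeNorm_pow hG hX]
      exact pow_le_pow_left₀ hd h.le 4
    rw [truncPow, indicator_of_mem hmem, ← kernel_eq hG hX, ← sub_one_mul, abs_mul, abs_of_nonneg hk]
    refine mul_le_of_le_one_left hk ?_
    rw [abs_le]
    constructor <;> linarith [hη.nonneg _ hd, hη.le_one _ hd]

/-- Enlarging the domain of integration to the whole group lets translation invariance remove `x`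
from the bound; this is the source of uniformity. -/
theorem abs_cutBarrier_sub_le (hG : IsHType G g) (hX : IsHorizontalBasis G g X) {α ε : ℝ}
    (hα : 0 < α) {η : ℝ → ℝ} (hη : IsCutoff ε η) {O : Set (Pt m n)}
    (h1 : ∀ x, IntegrableOn (kernel G g X α x) O)
    (h2 : ∀ x, IntegrableOn (cutKernel G g X α η x) O)
    (h3 : Integrable (truncPow G g X α ((2 * ε) ^ 4))) (x : Pt m n) :
    |cutBarrier G g X α η O x - barrier G g X α O x| ≤
      1 / α * ∫ y, truncPow G g X α ((2 * ε) ^ 4) y := by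
  rw [cutBarrier, barrier, ← mul_sub, abs_mul, abs_neg, abs_of_pos (by positivity : 0 < 1 / α),
    ← integral_sub (h2 x) (h1 x)]
  refine mul_le_mul_of_nonneg_left ?_ (by positivity)
  have h4 : Integrable fun ξ => truncPow G g X α ((2 * ε) ^ 4) (G.mul (G.inv x) ξ) :=
    (measurePreserving_mul_left G (G.inv x)).integrable_comp_of_integrable h3
  calc |∫ ξ in O, (cutKernel G g X α η x ξ - kernel G g X α x ξ)|
      ≤ ∫ ξ in O, |cutKernel G g X α η x ξ - kernel G g X α x ξ| := abs_integral_le_integral_abs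
    _ ≤ ∫ ξ in O, truncPow G g X α ((2 * ε) ^ 4) (G.mul (G.inv x) ξ) :=
        integral_mono ((h2 x).sub (h1 x)).abs h4.integrableOn
          fun ξ => hη.abs_sub_le hG hX x ξ
    _ ≤ ∫ ξ, truncPow G g X α ((2 * ε) ^ 4) (G.mul (G.inv x) ξ) :=
        setIntegral_le_integral h4 (Eventually.of_forall fun ξ => truncPow_nonneg hG _ _ _)
    _ = _ := integral_comp_mul_left G _ _

theorem tendstoUniformly_cutBarrier (hG : IsHType G g) (hX : IsHorizontalBasis G g X) {α : ℝ}
    (hα : 0 < α) (hαQ : α < homDim m n) {O : Set (Pt m n)} (hO : volume O ≠ ⊤) {η : ℝ → ℝ → ℝ}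
    (hη : ∀ ε, 0 < ε → IsCutoff ε (η ε))
    (h2 : ∀ ε, 0 < ε → ∀ x, IntegrableOn (cutKernel G g X α (η ε) x) O) :
    TendstoUniformly (fun ε => cutBarrier G g X α (η ε) O) (barrier G g X α O) (𝓝[>] 0) := by
  rw [Metric.tendstoUniformly_iff]
  intro e he
  have hlim := (tendsto_integral_truncPow hG hX hα hαQ).const_mul (1 / α)
  rw [mul_zero] at hlim
  have hhalf : ∀ᶠ ε : ℝ in 𝓝[>] 0, ε < 1 / 2 :=
    nhdsWithin_le_nhds (Iio_mem_nhds (by norm_num))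
  filter_upwards [hlim.eventually_lt_const he, self_mem_nhdsWithin, hhalf] with ε h1 hε hε2 x
  have hε' : 0 < ε := hε
  rw [dist_comm, Real.dist_eq]
  refine lt_of_le_of_lt (abs_cutBarrier_sub_le hG hX hα (hη ε hε)
    (integrableOn_kernel hG hX hα hαQ hO) (h2 ε hε) ?_ x) h1
  refine (integrable_truncPow_one hG hX hα hαQ).mono'
    (measurable_truncPow hG hX α _).aestronglyMeasurable (Eventually.of_forall fun y => ?_)
  rw [Real.norm_of_nonneg (truncPow_nonneg hG _ _ _)]
  exact truncPow_mono hG α (pow_le_one₀ (by linarith) (by linarith)) y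

end Integrability

/-! ### Smooth dependence of integrals on parameters -/

section Parametric

theorem integrableOn_of_continuous_of_subset {H F : Type*} [TopologicalSpace H] [T2Space H]
    [MeasurableSpace H] [BorelSpace H] [TopologicalSpace.PseudoMetrizableSpace H]
    [NormedAddCommGroup F] {μ : Measure H} [IsFiniteMeasureOnCompacts μ] {S T : Set H} {f : H → F}
    (hf : Continuous f) (hT : IsCompact T) (hST : S ⊆ T) : IntegrableOn f S μ :=
  (hf.continuousOn.integrableOn_compact hT).mono_set hST

variable {E H F : Type} [NormedAddCommGroup E] [NormedSpace ℝ E] [FiniteDimensional ℝ E]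
  [NormedAddCommGroup H] [NormedSpace ℝ H] [MeasurableSpace H] [BorelSpace H]
  {μ : Measure H} [IsFiniteMeasureOnCompacts μ] {S T : Set H}

/-- Differentiation under the integral sign over a relatively compact set. -/
theorem hasFDerivAt_setIntegral [NormedAddCommGroup F] [NormedSpace ℝ F] {K : E × H → F}
    (hK : ContDiff ℝ ∞ K) (hT : IsCompact T) (hST : S ⊆ T)
    (x : E) : HasFDerivAt (fun x => ∫ ξ in S, K (x, ξ) ∂μ)
      (∫ ξ in S, (fderiv ℝ K (x, ξ)).comp (ContinuousLinearMap.inl ℝ E H) ∂μ) x := by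
  have : ProperSpace E := FiniteDimensional.proper ℝ E
  have hK' : Continuous fun p => (fderiv ℝ K p).comp (ContinuousLinearMap.inl ℝ E H) :=
    (hK.continuous_fderiv (by simp)).clm_comp continuous_const
  obtain ⟨C, hC⟩ := ((isCompact_closedBall x 1).prod hT).exists_bound_of_continuousOn
    hK'.continuousOn
  have hfin : μ S ≠ ⊤ := ((measure_mono hST).trans_lt hT.measure_lt_top).ne
  have hslice : ∀ x : E, Continuous fun ξ : H => (x, ξ) := fun x => by fun_prop
  refine hasFDerivAt_integral_of_dominated_of_fderiv_le (s := Metric.closedBall x 1)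
    (F' := fun x ξ => (fderiv ℝ K (x, ξ)).comp (ContinuousLinearMap.inl ℝ E H))
    (bound := fun _ => C) (Metric.closedBall_mem_nhds x one_pos)
    (Eventually.of_forall fun y => ?_) ?_ ?_ ?_ (integrableOn_const hfin) ?_
  · exact (integrableOn_of_continuous_of_subset (hK.continuous.comp (hslice y)) hT hST).1
  · exact integrableOn_of_continuous_of_subset (hK.continuous.comp (hslice x)) hT hST
  · exact (integrableOn_of_continuous_of_subset (hK'.comp (hslice x)) hT hST).1
  · refine ae_restrict_of_ae_restrict_of_subset hST ?_
    filter_upwards [ae_restrict_mem hT.measurableSet] with ξ hξ y hy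
    exact hC (y, ξ) ⟨hy, hξ⟩
  · refine Eventually.of_forall fun ξ y _ => ?_
    exact ((hK.differentiable (by simp)) (y, ξ)).hasFDerivAt.comp y
      (hasFDerivAt_prodMk_left y ξ)

theorem contDiff_nat_setIntegral (k : ℕ) : ∀ {F : Type} [NormedAddCommGroup F] [NormedSpace ℝ F]
    {K : E × H → F}, ContDiff ℝ ∞ K → IsCompact T → S ⊆ T →
    ContDiff ℝ k (fun x => ∫ ξ in S, K (x, ξ) ∂μ) := by
  induction k with
  | zero =>
    intro F _ _ K hK hT hST
    have : Differentiable ℝ (fun x => ∫ ξ in S, K (x, ξ) ∂μ) := fun x =>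
      (hasFDerivAt_setIntegral hK hT hST x).differentiableAt
    exact contDiff_zero.2 this.continuous
  | succ k ih =>
    intro F _ _ K hK hT hST
    refine contDiff_succ_iff_hasFDerivAt.2 ⟨_, ?_, hasFDerivAt_setIntegral hK hT hST⟩
    -- The derivative is again an integral of a smooth kernel, valued in a space of linear maps;
    -- hence the induction is over all target spaces at once.
    exact ih (K := fun p => (fderiv ℝ K p).comp (ContinuousLinearMap.inl ℝ E H))
      ((hK.fderiv_right (by simp)).clm_comp contDiff_const) hT hST

theorem contDiff_setIntegral [NormedAddCommGroup F] [NormedSpace ℝ F] {K : E × H → F}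
    (hK : ContDiff ℝ ∞ K) (hT : IsCompact T) (hST : S ⊆ T) :
    ContDiff ℝ ∞ (fun x => ∫ ξ in S, K (x, ξ) ∂μ) :=
  contDiff_infty.2 fun k => contDiff_nat_setIntegral k hK hT hST

end Parametric

/-! ### Left-invariant operators under the integral sign -/

section Barrier

variable {G : HomogeneousLieGroup m n} {S T : Set (Pt m n)}

theorem contDiff_leftInv (G : HomogeneousLieGroup m n) (w : Pt m n) :
    ContDiff ℝ ∞ (leftInv G w) := by
  rw [funext (leftInv_eq G w)]
  exact contDiff_const.add ((twist G).flip w).contDiff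

theorem contDiff_along_param (G : HomogeneousLieGroup m n) (w : Pt m n) {K : Pt m n × Pt m n → ℝ}
    (hK : ContDiff ℝ ∞ K) :
    ContDiff ℝ ∞ fun p : Pt m n × Pt m n => along G w (fun x => K (x, p.2)) p.1 := by
  have h : ∀ p : Pt m n × Pt m n, along G w (fun x => K (x, p.2)) p.1 =
      fderiv ℝ K p (leftInv G w p.1, 0) := by
    intro p
    have : HasFDerivAt (fun x => K (x, p.2)) _ p.1 :=
      ((hK.differentiable (by simp)) p).hasFDerivAt.comp p.1 (hasFDerivAt_prodMk_left p.1 p.2)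
    rw [along_eq this]; simp
  rw [funext h]
  exact (hK.fderiv_right (by simp)).clm_apply
    (((contDiff_leftInv G w).comp contDiff_fst).prodMk contDiff_const)

theorem along_setIntegral (G : HomogeneousLieGroup m n) (w : Pt m n) {K : Pt m n × Pt m n → ℝ}
    (hK : ContDiff ℝ ∞ K) (hT : IsCompact T) (hST : S ⊆ T) :
    along G w (fun x => ∫ ξ in S, K (x, ξ)) =
      fun x => ∫ ξ in S, along G w (fun x => K (x, ξ)) x := by
  funext x
  have hK' : Continuous fun p => (fderiv ℝ K p).comp (ContinuousLinearMap.inl ℝ (Pt m n) (Pt m n)) :=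
    (hK.continuous_fderiv (by simp)).clm_comp continuous_const
  have hint : IntegrableOn (fun ξ => (fderiv ℝ K (x, ξ)).comp
      (ContinuousLinearMap.inl ℝ (Pt m n) (Pt m n))) S :=
    integrableOn_of_continuous_of_subset (hK'.comp (by fun_prop)) hT hST
  rw [along_eq (hasFDerivAt_setIntegral hK hT hST x), ContinuousLinearMap.integral_apply hint]
  congr 1
  funext ξ
  have : HasFDerivAt (fun x => K (x, ξ)) _ x :=
    ((hK.differentiable (by simp)) (x, ξ)).hasFDerivAt.comp x (hasFDerivAt_prodMk_left x ξ)
  rw [along_eq this]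

theorem continuous_along_along_param (G : HomogeneousLieGroup m n) (v w : Pt m n)
    {K : Pt m n × Pt m n → ℝ} (hK : ContDiff ℝ ∞ K) (x : Pt m n) :
    Continuous fun ξ => along G v (along G w fun x => K (x, ξ)) x :=
  (contDiff_along_param G v (K := fun p => along G w (fun x => K (x, p.2)) p.1)
    (contDiff_along_param G w hK)).continuous.comp (Continuous.prodMk_right x)

theorem integrableOn_sum_along_along (G : HomogeneousLieGroup m n) (X : Fin m → Pt m n)
    (A : Matrix (Fin m) (Fin m) ℝ) {K : Pt m n × Pt m n → ℝ}
    (hK : ContDiff ℝ ∞ K) (hT : IsCompact T) (hST : S ⊆ T) (x : Pt m n) :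
    IntegrableOn (fun ξ => ∑ i, ∑ j, A i j *
      along G (X i) (along G (X j) fun x => K (x, ξ)) x) S :=
  integrableOn_of_continuous_of_subset (continuous_finsetSum _ fun i _ =>
    continuous_finsetSum _ fun j _ => continuous_const.mul
      (continuous_along_along_param G (X i) (X j) hK x)) hT hST

/-- Left-invariant second-order operators pass under the integral sign. -/
theorem sum_along_along_setIntegral (G : HomogeneousLieGroup m n) (X : Fin m → Pt m n)
    (A : Matrix (Fin m) (Fin m) ℝ) {K : Pt m n × Pt m n → ℝ}
    (hK : ContDiff ℝ ∞ K) (hT : IsCompact T) (hST : S ⊆ T) (x : Pt m n) :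
    ∑ i, ∑ j, A i j * along G (X i) (along G (X j) fun x => ∫ ξ in S, K (x, ξ)) x =
      ∫ ξ in S, ∑ i, ∑ j, A i j * along G (X i) (along G (X j) fun x => K (x, ξ)) x := by
  have hint : ∀ i j, IntegrableOn
      (fun ξ => A i j * along G (X i) (along G (X j) fun x => K (x, ξ)) x) S :=
    fun i j => (integrableOn_of_continuous_of_subset
      (continuous_along_along_param G (X i) (X j) hK x) hT hST).const_mul _
  rw [integral_finsetSum _ fun i _ => integrable_finsetSum _ fun j _ => hint i j]
  refine Finset.sum_congr rfl fun i _ => ?_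
  rw [integral_finsetSum _ fun j _ => hint i j]
  refine Finset.sum_congr rfl fun j _ => ?_
  rw [integral_const_mul, along_setIntegral G (X j) hK hT hST,
    along_setIntegral G (X i) (K := fun p => along G (X j) (fun x => K (x, p.2)) p.1)
      (contDiff_along_param G (X j) hK) hT hST]

end Barrier

/-! ### One-variable profiles: truncation at the pole and compact support -/

section Profiles

/-- Real powers are smooth away from 0 only; a factor vanishing below a positive level hides the
singularity. -/
theorem contDiff_of_eq_zero_of_pos {f : ℝ → ℝ} {a : ℝ} (ha : 0 < a) (h0 : ∀ s < a, f s = 0)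
    (h : ∀ s, 0 < s → ContDiffAt ℝ ∞ f s) : ContDiff ℝ ∞ f := by
  refine contDiff_iff_contDiffAt.2 fun s => ?_
  rcases lt_or_ge s a with hs | hs
  · refine (contDiffAt_const (c := (0 : ℝ))).congr_of_eventuallyEq ?_
    filter_upwards [Iio_mem_nhds hs] with t ht using h0 t ht
  · exact h s (ha.trans_le hs)

theorem contDiffAt_rpow_const {s : ℝ} (hs : 0 < s) (c : ℝ) :
    ContDiffAt ℝ ∞ (fun t : ℝ => t ^ c) s :=
  contDiffAt_id.rpow_const_of_ne hs.ne'

/-- The truncated kernel as a function of the fourth power of the gauge. -/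
def cutProfile (α : ℝ) (η : ℝ → ℝ) (s : ℝ) : ℝ :=
  if s ≤ 0 then 0 else η (s ^ (1 / 4 : ℝ)) * s ^ (-(α / 4))

theorem cutProfile_of_pos (α : ℝ) (η : ℝ → ℝ) {s : ℝ} (hs : 0 < s) :
    cutProfile α η s = η (s ^ (1 / 4 : ℝ)) * s ^ (-(α / 4)) := by
  rw [cutProfile, if_neg hs.not_ge]

theorem contDiff_cutProfile {α ε : ℝ} (hε : 0 < ε) {η : ℝ → ℝ} (hη : IsCutoff ε η) :
    ContDiff ℝ ∞ (cutProfile α η) := by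
  refine contDiff_of_eq_zero_of_pos (pow_pos hε 4) (fun s hs => ?_) fun s hs => ?_
  · rcases le_or_gt s 0 with h | h
    · rw [cutProfile, if_pos h]
    · have h1 : s ^ (1 / 4 : ℝ) < ε := by
        have := Real.rpow_lt_rpow h.le hs (by norm_num : (0 : ℝ) < 1 / 4)
        rwa [← Real.rpow_natCast, ← Real.rpow_mul hε.le, show ((4 : ℕ) : ℝ) * (1 / 4) = 1 by norm_num,
          Real.rpow_one] at this
      rw [cutProfile_of_pos α η h, hη.eq_zero _ (by positivity) h1, zero_mul]
  · have h1 : ContDiffAt ℝ ∞ η (s ^ (1 / 4 : ℝ)) :=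
      hη.smooth.contDiffAt (Ici_mem_nhds (by positivity))
    refine ((h1.comp s (contDiffAt_rpow_const hs (1 / 4))).mul
      (contDiffAt_rpow_const hs (-(α / 4)))).congr_of_eventuallyEq ?_
    filter_upwards [Ioi_mem_nhds hs] with t ht using cutProfile_of_pos α η ht

theorem cutProfile_of_ge {α ε : ℝ} (hε : 0 < ε) {η : ℝ → ℝ} (hη : IsCutoff ε η) {s : ℝ}
    (hs : (2 * ε) ^ 4 ≤ s) : cutProfile α η s = s ^ (-(α / 4)) := by
  have hpos : 0 < s := lt_of_lt_of_le (by positivity) hs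
  have h1 : 2 * ε ≤ s ^ (1 / 4 : ℝ) := by
    have := Real.rpow_le_rpow (by positivity) hs (by norm_num : (0 : ℝ) ≤ 1 / 4)
    rwa [← Real.rpow_natCast, ← Real.rpow_mul (by positivity),
      show ((4 : ℕ) : ℝ) * (1 / 4) = 1 by norm_num, Real.rpow_one] at this
  rw [cutProfile_of_pos α η hpos, hη.eq_one _ h1, one_mul]

/-- A smooth step from `0` to `1` over the interval `[σ, 2σ]`. -/
def step (σ s : ℝ) : ℝ := Real.smoothTransition ((s - σ) / σ)

/-- The derivative of `step`. -/
def stepDeriv (σ s : ℝ) : ℝ := deriv Real.smoothTransition ((s - σ) / σ) / σ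

theorem step_of_le {σ s : ℝ} (hσ : 0 < σ) (hs : s ≤ σ) : step σ s = 0 :=
  Real.smoothTransition.zero_of_nonpos (div_nonpos_of_nonpos_of_nonneg (by linarith) hσ.le)

theorem step_of_ge {σ s : ℝ} (hσ : 0 < σ) (hs : 2 * σ ≤ s) : step σ s = 1 :=
  Real.smoothTransition.one_of_one_le ((one_le_div hσ).2 (by linarith))

theorem contDiff_step (σ : ℝ) : ContDiff ℝ ∞ (step σ) :=
  Real.smoothTransition.contDiff.comp ((contDiff_id.sub contDiff_const).div_const σ)

theorem hasDerivAt_step (σ s : ℝ) : HasDerivAt (step σ) (stepDeriv σ s) s := by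
  have h1 : HasDerivAt (fun s : ℝ => (s - σ) / σ) (1 / σ) s :=
    ((hasDerivAt_id s).sub_const σ).div_const σ
  have h2 : HasDerivAt Real.smoothTransition (deriv Real.smoothTransition ((s - σ) / σ))
      ((s - σ) / σ) :=
    ((Real.smoothTransition.contDiff (n := 1)).differentiable (by simp) _).hasDerivAt
  have := h2.comp s h1
  rwa [mul_one_div] at this

theorem deriv_step (σ : ℝ) : deriv (step σ) = stepDeriv σ :=
  funext fun s => (hasDerivAt_step σ s).deriv

theorem contDiff_stepDeriv (σ : ℝ) : ContDiff ℝ ∞ (stepDeriv σ) := by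
  rw [← deriv_step]; exact (contDiff_infty_iff_deriv.1 (contDiff_step σ)).2

theorem stepDeriv_nonneg {σ : ℝ} (hσ : 0 < σ) (s : ℝ) : 0 ≤ stepDeriv σ s :=
  div_nonneg Real.smoothTransition.monotone.deriv_nonneg hσ.le

theorem stepDeriv_of_lt {σ s : ℝ} (hσ : 0 < σ) (hs : s < σ) : stepDeriv σ s = 0 := by
  rw [← deriv_step]
  have : step σ =ᶠ[𝓝 s] fun _ => 0 := by
    filter_upwards [Iio_mem_nhds hs] with t ht using step_of_le hσ (le_of_lt ht)
  rw [this.deriv_eq, deriv_const]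

theorem stepDeriv_of_gt {σ s : ℝ} (hσ : 0 < σ) (hs : 2 * σ < s) : stepDeriv σ s = 0 := by
  rw [← deriv_step]
  have : step σ =ᶠ[𝓝 s] fun _ => 1 := by
    filter_upwards [Ioi_mem_nhds hs] with t ht using step_of_ge hσ (le_of_lt ht)
  rw [this.deriv_eq, deriv_const]

/-- Mean value theorem: the step climbs from 0 to 1 over `[σ, 2σ]`. -/
theorem exists_stepDeriv_pos {σ : ℝ} (hσ : 0 < σ) : ∃ s, σ < s ∧ 0 < stepDeriv σ s := by
  obtain ⟨s, hs, h⟩ := exists_deriv_eq_slope (step σ) (by linarith : σ < 2 * σ)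
    (contDiff_step σ).continuous.continuousOn
    (fun s _ => (hasDerivAt_step σ s).differentiableAt.differentiableWithinAt)
  refine ⟨s, hs.1, ?_⟩
  rw [← deriv_step, h, step_of_ge hσ le_rfl, step_of_le hσ le_rfl]
  have : 0 < 2 * σ - σ := by linarith
  positivity

/-- The density of the correction that makes the kernel compactly supported. -/
def tailDensity (α σ s : ℝ) : ℝ := α / 4 * s ^ (-(α / 4) - 1) * step σ s

theorem tailDensity_of_le {α σ s : ℝ} (hσ : 0 < σ) (hs : s ≤ σ) : tailDensity α σ s = 0 := by
  rw [tailDensity, step_of_le hσ hs, mul_zero]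

theorem contDiff_tailDensity (α : ℝ) {σ : ℝ} (hσ : 0 < σ) : ContDiff ℝ ∞ (tailDensity α σ) :=
  contDiff_of_eq_zero_of_pos hσ (fun _ hs => tailDensity_of_le hσ hs.le) fun _ hs =>
    (contDiffAt_const.mul (contDiffAt_rpow_const hs _)).mul (contDiff_step σ).contDiffAt

/-- The correction that makes the kernel compactly supported, up to a constant. -/
def tail (α σ s : ℝ) : ℝ := ∫ t in σ..s, tailDensity α σ t

theorem hasDerivAt_tail (α : ℝ) {σ : ℝ} (hσ : 0 < σ) (s : ℝ) :
    HasDerivAt (tail α σ) (tailDensity α σ s) s :=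
  (contDiff_tailDensity α hσ).continuous.integral_hasStrictDerivAt σ s |>.hasDerivAt

theorem contDiff_tail (α : ℝ) {σ : ℝ} (hσ : 0 < σ) : ContDiff ℝ ∞ (tail α σ) := by
  refine contDiff_infty_iff_deriv.2 ⟨fun s => (hasDerivAt_tail α hσ s).differentiableAt, ?_⟩
  rw [funext fun s => (hasDerivAt_tail α hσ s).deriv]
  exact contDiff_tailDensity α hσ

theorem tail_of_le (α : ℝ) {σ s : ℝ} (hσ : 0 < σ) (hs : s ≤ σ) : tail α σ s = 0 := by
  rw [tail, intervalIntegral.integral_congr (g := fun _ => 0), intervalIntegral.integral_zero]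
  intro t ht
  rw [uIcc_of_ge hs] at ht
  exact tailDensity_of_le hσ ht.2

theorem hasDerivAt_rpow_neg (α : ℝ) {s : ℝ} (hs : 0 < s) :
    HasDerivAt (fun t : ℝ => t ^ (-(α / 4))) (-(α / 4) * s ^ (-(α / 4) - 1)) s :=
  Real.hasDerivAt_rpow_const (Or.inl hs.ne')

/-- The limit at infinity of the corrected kernel. -/
def tailConst (α σ : ℝ) : ℝ := (2 * σ) ^ (-(α / 4)) + tail α σ (2 * σ)

/-- Where the step equals 1 the tail density is exactly minus the derivative of the power, so the
sum is frozen; subtracting the frozen value gives compact support. -/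
theorem rpow_add_tail (α : ℝ) {σ s : ℝ} (hσ : 0 < σ) (hs : 2 * σ ≤ s) :
    s ^ (-(α / 4)) + tail α σ s = tailConst α σ := by
  have hd : ∀ t ∈ Icc (2 * σ) s, HasDerivAt (fun t : ℝ => t ^ (-(α / 4)) + tail α σ t) 0 t := by
    intro t ht
    have h := (hasDerivAt_rpow_neg α (by linarith [ht.1] : 0 < t)).fun_add (hasDerivAt_tail α hσ t)
    rw [tailDensity, step_of_ge hσ ht.1] at h
    refine h.congr_deriv ?_
    ring
  exact constant_of_has_deriv_right_zero (fun t ht => (hd t ht).continuousAt.continuousWithinAt)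
    (fun t ht => (hd t ⟨ht.1, ht.2.le⟩).hasDerivWithinAt) s ⟨hs, le_rfl⟩

/-- The compactly supported modification of the truncated kernel, as a function of the fourth power
of the gauge. -/
def compactProfile (α σ : ℝ) (η : ℝ → ℝ) (s : ℝ) : ℝ :=
  cutProfile α η s + tail α σ s - tailConst α σ

variable {α σ ε : ℝ} {η : ℝ → ℝ}

theorem contDiff_compactProfile (hσ : 0 < σ) (hε : 0 < ε) (hη : IsCutoff ε η) :
    ContDiff ℝ ∞ (compactProfile α σ η) :=
  ((contDiff_cutProfile hε hη).add (contDiff_tail α hσ)).sub contDiff_const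

theorem compactProfile_of_le (hσ : 0 < σ) {s : ℝ} (hs : s ≤ σ) :
    compactProfile α σ η s = cutProfile α η s - tailConst α σ := by
  rw [compactProfile, tail_of_le α hσ hs, add_zero]

theorem compactProfile_of_ge (hσ : 0 < σ) (hε : 0 < ε) (hη : IsCutoff ε η) {s : ℝ}
    (hs : 2 * σ ≤ s) (hs' : (2 * ε) ^ 4 ≤ s) : compactProfile α σ η s = 0 := by
  rw [compactProfile, cutProfile_of_ge hε hη hs', rpow_add_tail α hσ hs, sub_self]

theorem deriv_compactProfile (hσ : 0 < σ) (hε : 0 < ε) (hη : IsCutoff ε η) {s : ℝ}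
    (hs : (2 * ε) ^ 4 < s) :
    deriv (compactProfile α σ η) s = -(α / 4) * s ^ (-(α / 4) - 1) * (1 - step σ s) := by
  have hpos : 0 < s := lt_trans (by positivity) hs
  have h1 : HasDerivAt (cutProfile α η) (-(α / 4) * s ^ (-(α / 4) - 1)) s := by
    refine (hasDerivAt_rpow_neg α hpos).congr_of_eventuallyEq ?_
    filter_upwards [Ioi_mem_nhds hs] with t ht using cutProfile_of_ge hε hη (le_of_lt ht)
  have h2 : HasDerivAt (compactProfile α σ η) _ s :=
    (h1.fun_add (hasDerivAt_tail α hσ s)).sub_const (tailConst α σ)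
  rw [h2.deriv, tailDensity]; ring

/-- Switching off the decreasing power bends the profile upwards: the derivative of the step appears
with a plus sign when α > 0, and it is the source of the strict lower bound. -/
theorem deriv_deriv_compactProfile (hσ : 0 < σ) (hε : 0 < ε) (hη : IsCutoff ε η) {s : ℝ}
    (hs : (2 * ε) ^ 4 < s) :
    deriv (deriv (compactProfile α σ η)) s =
      α / 4 * s ^ (-(α / 4) - 1) * ((α / 4 + 1) / s * (1 - step σ s) + stepDeriv σ s) := by
  have hpos : 0 < s := lt_trans (by positivity) hs
  have h1 : deriv (compactProfile α σ η) =ᶠ[𝓝 s]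
      fun s => -(α / 4) * s ^ (-(α / 4) - 1) * (1 - step σ s) := by
    filter_upwards [Ioi_mem_nhds hs] with t ht using deriv_compactProfile hσ hε hη ht
  have h2 : HasDerivAt (fun t : ℝ => t ^ (-(α / 4) - 1))
      ((-(α / 4) - 1) * s ^ (-(α / 4) - 1 - 1)) s := Real.hasDerivAt_rpow_const (Or.inl hpos.ne')
  have h3 := (h2.const_mul (-(α / 4))).fun_mul ((hasDerivAt_step σ s).const_sub 1)
  rw [h1.deriv_eq, h3.deriv, Real.rpow_sub_one hpos.ne' (-(α / 4) - 1)]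
  field_simp
  ring

end Profiles

/-! ### The lower bound for the truncated barrier -/

section Main

variable {G : HomogeneousLieGroup m n} {g : LinearMap.BilinForm ℝ (Pt m n)}
  {X : Fin m → Pt m n} {α σ ε δ lam Lam : ℝ} {η : ℝ → ℝ}

theorem contDiff_inv_mul (G : HomogeneousLieGroup m n) :
    ContDiff ℝ ∞ fun p : Pt m n × Pt m n => G.mul (G.inv p.1) p.2 :=
  G.contDiff_mul.comp ((G.contDiff_inv.comp contDiff_fst).prodMk contDiff_snd)

/-- Both sides vanish at the pole, the left one because 0 raised to a nonzero exponent is 0; so the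
truncated kernel is a smooth function of N. -/
theorem cutKernel_eq (hG : IsHType G g) (hX : IsHorizontalBasis G g X) (hα : 0 < α)
    (η : ℝ → ℝ) (x ξ : Pt m n) :
    cutKernel G g X α η x ξ = cutProfile α η (gaugePow G g X (G.mul (G.inv x) ξ)) := by
  rw [cutKernel, kernel_eq hG hX, gaugeNorm_eq hG hX]
  rcases (gaugePow_nonneg hG (G.mul (G.inv x) ξ) (X := X)).eq_or_lt with h | h
  · rw [← h, cutProfile, if_pos le_rfl, Real.zero_rpow (x := -(α / 4)) (by linarith), mul_zero]
  · rw [cutProfile_of_pos α η h]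

theorem gaugeBall_subset (hG : IsHType G g) (hX : IsHorizontalBasis G g X) :
    gaugeBall G g X 1 ⊆ {x | gaugePow G g X x ≤ 1} := fun x hx => by
  rw [mem_ofPred_eq, gaugePow_eq_gaugeNorm_pow hG hX]
  exact pow_le_one₀ (gaugeNorm_nonneg hG hX x) (le_of_lt hx)

theorem contDiff_comp_gaugePow_left (hG : IsHType G g) (hX : IsHorizontalBasis G g X) {Ψ : ℝ → ℝ}
    (hΨ : ContDiff ℝ ∞ Ψ) :
    ContDiff ℝ ∞ fun p : Pt m n × Pt m n => Ψ (gaugePow G g X (G.mul (G.inv p.1) p.2)) :=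
  hΨ.comp ((contDiff_gaugePow hG hX).comp (contDiff_inv_mul G))

theorem integrableOn_cutKernel (hG : IsHType G g) (hX : IsHorizontalBasis G g X) (hα : 0 < α)
    (hε : 0 < ε) (hη : IsCutoff ε η) {O : Set (Pt m n)} (hO : O ⊆ gaugeBall G g X 1)
    (x : Pt m n) : IntegrableOn (cutKernel G g X α η x) O := by
  rw [funext (cutKernel_eq hG hX hα η x)]
  have hc : Continuous fun ξ => cutProfile α η (gaugePow G g X (G.mul (G.inv x) ξ)) :=
    (contDiff_cutProfile hε hη).continuous.comp ((contDiff_gaugePow hG hX (k := 0)).continuous.comp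
      (contDiff_mul_left G (G.inv x) (k := 0)).continuous)
  exact integrableOn_of_continuous_of_subset hc (isCompact_gaugePow_le hG hX 1)
    (hO.trans (gaugeBall_subset hG hX))

theorem contDiff_cutBarrier (hG : IsHType G g) (hX : IsHorizontalBasis G g X) (hα : 0 < α)
    (hε : 0 < ε) (hη : IsCutoff ε η) {O : Set (Pt m n)} (hO : O ⊆ gaugeBall G g X 1) :
    ContDiff ℝ ∞ (cutBarrier G g X α η O) := by
  unfold cutBarrier
  simp only [cutKernel_eq hG hX hα η]
  exact contDiff_const.mul (contDiff_setIntegral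
    (contDiff_comp_gaugePow_left hG hX (contDiff_cutProfile hε hη))
    (isCompact_gaugePow_le hG hX 1) (hO.trans (gaugeBall_subset hG hX)))

/-- The density of the lower bound. -/
def lowerDensity (G : HomogeneousLieGroup m n) (g : LinearMap.BilinForm ℝ (Pt m n))
    (X : Fin m → Pt m n) (α σ : ℝ) (y : Pt m n) : ℝ :=
  4 * horSq g X y * (gaugePow G g X y ^ (-(α / 4)) * stepDeriv σ (gaugePow G g X y))

theorem lowerDensity_nonneg (hG : IsHType G g) (hσ : 0 < σ) (y : Pt m n) :
    0 ≤ lowerDensity G g X α σ y :=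
  mul_nonneg (mul_nonneg (by norm_num) (horSq_nonneg y))
    (mul_nonneg (Real.rpow_nonneg (gaugePow_nonneg hG y) _) (stepDeriv_nonneg hσ _))

theorem continuous_lowerDensity (hG : IsHType G g) (hX : IsHorizontalBasis G g X) (hσ : 0 < σ) :
    Continuous (lowerDensity G g X α σ) := by
  have h : ContDiff ℝ ∞ fun s : ℝ => s ^ (-(α / 4)) * stepDeriv σ s :=
    contDiff_of_eq_zero_of_pos hσ (fun s hs => by rw [stepDeriv_of_lt hσ hs, mul_zero]) fun s hs =>
      (contDiffAt_rpow_const hs _).mul (contDiff_stepDeriv σ).contDiffAt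
  exact (continuous_const.mul (contDiff_horSq g X (k := 0)).continuous).mul
    (h.continuous.comp (contDiff_gaugePow hG hX (k := 0)).continuous)

theorem lowerDensity_of_lt (hσ : 0 < σ) {y : Pt m n} (hy : gaugePow G g X y < σ) :
    lowerDensity G g X α σ y = 0 := by
  rw [lowerDensity, stepDeriv_of_lt hσ hy, mul_zero, mul_zero]

theorem lowerDensity_of_gt (hσ : 0 < σ) {y : Pt m n} (hy : 2 * σ < gaugePow G g X y) :
    lowerDensity G g X α σ y = 0 := by
  rw [lowerDensity, stepDeriv_of_gt hσ hy, mul_zero, mul_zero]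

/-- The density is continuous, nonnegative and compactly supported, so one positive value suffices.
A point with nonzero first component is dilated to a level of N where the step is strictly
increasing. -/
theorem integral_lowerDensity_pos (hG : IsHType G g) (hX : IsHorizontalBasis G g X) (hm : 0 < m)
    (hσ : 0 < σ) : 0 < ∫ y, lowerDensity G g X α σ y := by
  obtain ⟨s, hs, hspos⟩ := exists_stepDeriv_pos hσ
  have hs0 : 0 < s := hσ.trans hs
  set a : Fin m → ℝ := fun _ => 1 with ha
  have ha0 : a ≠ 0 := fun h => by
    have := congrFun h ⟨0, hm⟩
    simp [ha] at this
  have hp : 0 < splitPow g X ((a, 0) : Pt m n) :=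
    add_pos_of_pos_of_nonneg (pow_pos (horSq_pos hG hX ha0) 2)
      (mul_nonneg (by norm_num) (hG.nonneg _))
  set p := splitPow g X ((a, 0) : Pt m n) with hpdef
  set r : ℝ := (s / p) ^ (1 / 4 : ℝ) with hr
  have hr0 : 0 < r := Real.rpow_pos_of_pos (div_pos hs0 hp) _
  have hr4 : r ^ 4 = s / p := by
    rw [hr, ← Real.rpow_natCast, ← Real.rpow_mul (div_pos hs0 hp).le]
    norm_num
  set y := unsplit G g X (dil r (a, 0)) with hy
  have hNy : gaugePow G g X y = s := by
    rw [gaugePow_eq_splitPow hG hX, hy, split_unsplit, splitPow_dil, hr4, ← hpdef]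
    field_simp
  have hSy : 0 < horSq g X y := by
    rw [horSq_fst hG hX]
    exact horSq_pos hG hX (smul_ne_zero hr0.ne' ha0)
  refine (continuous_lowerDensity hG hX hσ).integral_pos_of_hasCompactSupport_nonneg_nonzero
    (x := y) (HasCompactSupport.intro (isCompact_gaugePow_le hG hX (2 * σ)) fun z hz => ?_)
    (fun z => lowerDensity_nonneg hG hσ z) ?_
  · exact lowerDensity_of_gt hσ (not_le.1 hz)
  · rw [lowerDensity, hNy]
    positivity

/-- The pointwise lower bound away from the truncated singularity. -/
theorem lowerDensity_le (hG : IsHType G g) (hX : IsHorizontalBasis G g X) (hα : 0 < α)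
    (hαδ : α = homDim m n - δ) (hδ : δ ≤ 2) (hσ : 0 < σ) (hε : 0 < ε) (hη : IsCutoff ε η)
    {A : Matrix (Fin m) (Fin m) ℝ} (hA : IsElliptic lam Lam A) (hL : Landis n δ A) {y : Pt m n}
    (hy : (2 * ε) ^ 4 < gaugePow G g X y) :
    α * lam * lowerDensity G g X α σ y ≤ ∑ i, ∑ j, A i j *
      along G (X i) (along G (X j) fun y => compactProfile α σ η (gaugePow G g X y)) y := by
  rw [opL_comp_gaugePow hG hX (contDiff_compactProfile hσ hε hη),
    deriv_compactProfile hσ hε hη hy, deriv_deriv_compactProfile hσ hε hη hy, lowerDensity]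
  have hlan := landis_bound hG hX hδ hA hL y
  have hell := (hA.2 (gaugeGrad G g X y)).1
  rw [sum_sq_gaugeGrad hG hX] at hell
  set s := gaugePow G g X y
  set E := (A *ᵥ gaugeGrad G g X y) ⬝ᵥ gaugeGrad G g X y
  set L := ∑ i, ∑ j, A i j * gaugeHess G g X y i j
  set S := horSq g X y
  set τ := stepDeriv σ s
  have hs : 0 < s := lt_trans (by positivity) hy
  have hτ : 0 ≤ τ := stepDeriv_nonneg hσ s
  have hχ : 0 ≤ 1 - step σ s := by
    have := Real.smoothTransition.le_one ((s - σ) / σ)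
    unfold step; linarith
  have hp : 0 < s ^ (-(α / 4) - 1) := Real.rpow_pos_of_pos hs _
  have hps : s ^ (-(α / 4)) = s ^ (-(α / 4) - 1) * s := by
    rw [Real.rpow_sub_one hs.ne']; field_simp
  rw [hps]
  set p := s ^ (-(α / 4) - 1)
  set χ := 1 - step σ s
  -- The Landis bound with Q + 4 - δ = α + 4: the pure power of the gauge is a subsolution.
  have h1 : 0 ≤ (α / 4 + 1) / s * E - L := by
    have : L ≤ (α / 4 + 1) / s * E := by
      rw [div_mul_eq_mul_div, le_div_iff₀ hs]
      have h4 : homDim m n + 4 - δ = α + 4 := by rw [hαδ]; ring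
      rw [h4] at hlan
      linarith
    linarith
  have h2 : 0 ≤ α / 4 * p * χ * ((α / 4 + 1) / s * E - L) := by positivity
  -- The term with the derivative of the step needs only ellipticity and |∇N|² = 16 S N.
  have h3 : α / 4 * p * τ * (lam * (16 * S * s)) ≤ α / 4 * p * τ * E :=
    mul_le_mul_of_nonneg_left hell (by positivity)
  calc α * lam * (4 * S * (p * s * τ)) = α / 4 * p * τ * (lam * (16 * S * s)) := by ring
    _ ≤ α / 4 * p * τ * E + α / 4 * p * χ * ((α / 4 + 1) / s * E - L) := by linarith
    _ = _ := by ring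

theorem along_along_congr {O : Set (Pt m n)} (hO : IsOpen O) {f h : Pt m n → ℝ} {c d : ℝ}
    (hh : ContDiff ℝ ∞ h) (hfh : ∀ y ∈ O, f y = c * h y + d) (v w : Pt m n) {x : Pt m n}
    (hx : x ∈ O) : along G v (along G w f) x = c * along G v (along G w h) x := by
  have key : ∀ {f h : Pt m n → ℝ} {d : ℝ}, ContDiff ℝ ∞ h → (∀ y ∈ O, f y = c * h y + d) →
      ∀ w, ∀ y ∈ O, along G w f y = c * along G w h y := by
    intro f h d hh hfh w y hy
    have h1 : HasFDerivAt (fun y => c * h y + d) (c • fderiv ℝ h y) y :=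
      (((hh.differentiable (by simp)) y).hasFDerivAt.const_mul c).add_const d
    have h2 : HasFDerivAt f (c • fderiv ℝ h y) y := h1.congr_of_eventuallyEq
      (by filter_upwards [hO.mem_nhds hy] with z hz using hfh z hz)
    rw [along_eq h2]; rfl
  exact key (d := 0) (contDiff_along G w hh) (fun y hy => by rw [key hh hfh w y hy, add_zero]) v x hx

/-- Chosen from the unit gauge ball alone, σ, and with it the final constant, is independent of O
and ε. Modifying the kernel beyond σ leaves interactions inside O unchanged up to a constant. -/
theorem exists_bound_gaugePow (hG : IsHType G g) (hX : IsHorizontalBasis G g X) :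
    ∃ σ : ℝ, 0 < σ ∧ ∀ x ξ : Pt m n, gaugePow G g X x ≤ 1 → gaugePow G g X ξ ≤ 1 →
      gaugePow G g X (G.mul (G.inv x) ξ) < σ := by
  have hc : Continuous fun p : Pt m n × Pt m n => gaugePow G g X (G.mul (G.inv p.1) p.2) :=
    (contDiff_gaugePow hG hX (k := 0)).continuous.comp (contDiff_inv_mul G).continuous
  obtain ⟨C, hC⟩ := ((isCompact_gaugePow_le hG hX 1).prod
    (isCompact_gaugePow_le hG hX 1)).exists_bound_of_continuousOn hc.continuousOn
  refine ⟨|C| + 1, by positivity, fun x ξ hx hξ => ?_⟩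
  have := hC (x, ξ) ⟨hx, hξ⟩
  have h2 := Real.le_norm_self (gaugePow G g X (G.mul (G.inv x) ξ))
  have h3 := le_abs_self C
  simp only at this
  linarith

/-- On `O` the truncated potential is, up to a constant, the potential of the complement for the
compactly supported kernel. -/
theorem cutBarrier_eq_add_const (hG : IsHType G g) (hX : IsHorizontalBasis G g X) (hα : 0 < α)
    (hσ : 0 < σ) (hε : 0 < ε) (hη : IsCutoff ε η)
    (hσb : ∀ x ξ : Pt m n, gaugePow G g X x ≤ 1 → gaugePow G g X ξ ≤ 1 →
      gaugePow G g X (G.mul (G.inv x) ξ) < σ)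
    {O T : Set (Pt m n)} (hO : IsOpen O) (hOB : O ⊆ gaugeBall G g X 1)
    (hT : ∀ x ∈ O, ∀ ξ ∉ T, max (2 * σ) ((2 * ε) ^ 4) ≤ gaugePow G g X (G.mul (G.inv x) ξ)) :
    ∃ d : ℝ, ∀ x ∈ O, cutBarrier G g X α η O x =
      1 / α * (∫ ξ in T \ O, compactProfile α σ η (gaugePow G g X (G.mul (G.inv ξ) x))) + d := by
  set F : Pt m n → ℝ := fun y => compactProfile α σ η (gaugePow G g X y) with hF
  have hFc : Continuous F := (contDiff_compactProfile hσ hε hη).continuous.comp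
    (contDiff_gaugePow hG hX (k := 0)).continuous
  have hFi : Integrable F := hFc.integrable_of_hasCompactSupport
    (HasCompactSupport.intro (isCompact_gaugePow_le hG hX (max (2 * σ) ((2 * ε) ^ 4))) fun z hz => by
      have hz' : max (2 * σ) ((2 * ε) ^ 4) < gaugePow G g X z := not_le.1 hz
      exact compactProfile_of_ge hσ hε hη ((le_max_left _ _).trans hz'.le)
        ((le_max_right _ _).trans hz'.le))
  have hsub := hOB.trans (gaugeBall_subset hG hX)
  have hfin : volume O ≠ ⊤ :=
    ((measure_mono hsub).trans_lt (isCompact_gaugePow_le hG hX 1).measure_lt_top).ne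
  -- The total mass of `F` is independent of `x` by translation invariance, and inside `O` the two
  -- kernels differ by `tailConst`; both contributions are constants.
  refine ⟨-(1 / α) * ((∫ y, F y) + volume.real O * tailConst α σ), fun x hx => ?_⟩
  have hxi : Integrable fun ξ => F (G.mul (G.inv x) ξ) :=
    (measurePreserving_mul_left G (G.inv x)).integrable_comp_of_integrable hFi
  have h1 : ∫ ξ in O, cutKernel G g X α η x ξ =
      (∫ ξ in O, F (G.mul (G.inv x) ξ)) + volume.real O * tailConst α σ := by
    rw [← smul_eq_mul (volume.real O), ← setIntegral_const,
      ← integral_add hxi.integrableOn (integrableOn_const hfin)]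
    refine setIntegral_congr_fun hO.measurableSet fun ξ hξ => ?_
    simp only [hF]
    rw [cutKernel_eq hG hX hα η,
      compactProfile_of_le hσ (hσb x ξ (hsub hx) (hsub hξ)).le]
    ring
  have h2 : ∫ ξ in Oᶜ, F (G.mul (G.inv x) ξ) = ∫ ξ in T \ O, F (G.mul (G.inv x) ξ) := by
    have hTO : T \ O ⊆ Oᶜ := fun ξ hξ => hξ.2
    refine setIntegral_eq_of_subset_of_forall_sdiff_eq_zero hO.measurableSet.compl hTO
      fun ξ hξ => ?_
    have hξT : ξ ∉ T := fun h => hξ.2 ⟨h, hξ.1⟩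
    have h := hT x hx ξ hξT
    exact compactProfile_of_ge hσ hε hη ((le_max_left _ _).trans h) ((le_max_right _ _).trans h)
  have h3 := integral_add_compl hO.measurableSet hxi
  rw [integral_comp_mul_left, h2] at h3
  have h4 : ∫ ξ in T \ O, compactProfile α σ η (gaugePow G g X (G.mul (G.inv ξ) x)) =
      ∫ ξ in T \ O, F (G.mul (G.inv x) ξ) := by
    simp only [hF, gaugePow_inv_mul_comm hG hX x]
  rw [cutBarrier, h1, h4, ← h3]
  ring

/-- The operator is applied to the integral over the complement of O, where the kernel is smooth and
the pointwise bound holds. The factor 1/α cancels the α of that bound, so the constant is the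
integral of the density itself. -/
theorem le_opL_cutBarrier (hG : IsHType G g) (hX : IsHorizontalBasis G g X) (hα : 0 < α)
    (hαδ : α = homDim m n - δ) (hδ : δ ≤ 2) (hσ : 0 < σ) (hε : 0 < ε) (hη : IsCutoff ε η)
    (hσb : ∀ x ξ : Pt m n, gaugePow G g X x ≤ 1 → gaugePow G g X ξ ≤ 1 →
      gaugePow G g X (G.mul (G.inv x) ξ) < σ)
    {O O' : Set (Pt m n)} (hO : IsOpen O) (hOB : O ⊆ gaugeBall G g X 1) (hO' : O' ⊆ O)
    (hdist : 2 * ε < gaugeDist G g X O' (frontier O))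
    {A : Pt m n → Matrix (Fin m) (Fin m) ℝ} {x : Pt m n} (hx : x ∈ O')
    (hA : IsElliptic lam Lam (A x)) (hL : Landis n δ (A x)) :
    (∫ y, lowerDensity G g X α σ y) * lam ≤ opL G X A (cutBarrier G g X α η O) x := by
  have hsub := hOB.trans (gaugeBall_subset hG hX)
  set R := max (2 * σ) ((2 * ε) ^ 4) with hR
  -- One compact set containing, for every `x` in `O`, all ξ at which the modified kernel can be
  -- nonzero; it permits differentiation under the integral.
  set T : Set (Pt m n) := (fun p : Pt m n × Pt m n => G.mul p.1 p.2) ''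
    ({x | gaugePow G g X x ≤ 1} ×ˢ {y | gaugePow G g X y ≤ R}) with hTdef
  have hTc : IsCompact T := ((isCompact_gaugePow_le hG hX 1).prod
    (isCompact_gaugePow_le hG hX R)).image G.contDiff_mul.continuous
  have hcancel : ∀ x ξ, G.mul x (G.mul (G.inv x) ξ) = ξ := fun x ξ => by
    rw [← G.mul_assoc, G.mul_inv, G.zero_mul]
  have hT : ∀ x ∈ O, ∀ ξ ∉ T, R < gaugePow G g X (G.mul (G.inv x) ξ) := by
    intro x hx ξ hξ
    by_contra h
    exact hξ ⟨(x, G.mul (G.inv x) ξ), ⟨hsub hx, not_lt.1 h⟩, hcancel x ξ⟩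
  obtain ⟨d, hd⟩ := cutBarrier_eq_add_const hG hX hα hσ hε hη hσb hO hOB
    fun x hx ξ hξ => (hT x hx ξ hξ).le
  have hinvmul : ContDiff ℝ ∞ fun p : Pt m n × Pt m n => G.mul (G.inv p.2) p.1 :=
    (contDiff_inv_mul G).comp (contDiff_snd.prodMk contDiff_fst)
  have hΨ : ContDiff ℝ ∞ (compactProfile α σ η) := contDiff_compactProfile hσ hε hη
  set K : Pt m n × Pt m n → ℝ :=
    fun p => compactProfile α σ η (gaugePow G g X (G.mul (G.inv p.2) p.1)) with hK
  have hKs : ContDiff ℝ ∞ K := hΨ.comp ((contDiff_gaugePow hG hX).comp hinvmul)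
  have hTO : T \ O ⊆ T := sdiff_subset
  have hHs : ContDiff ℝ ∞ fun x => ∫ ξ in T \ O, K (x, ξ) := contDiff_setIntegral hKs hTc hTO
  have hcomp : ∀ ξ i j, along G (X i) (along G (X j) fun x => K (x, ξ)) x =
      along G (X i) (along G (X j) fun y => compactProfile α σ η (gaugePow G g X y))
        (G.mul (G.inv ξ) x) := by
    intro ξ i j
    have hs : ContDiff ℝ ∞ fun y => compactProfile α σ η (gaugePow G g X y) :=
      hΨ.comp (contDiff_gaugePow hG hX)
    have h1 := along_comp_mul_left (G := G) (X j) (G.inv ξ) (hs.differentiable (by simp))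
    have h2 := along_comp_mul_left (G := G) (X i) (G.inv ξ)
      ((contDiff_along G (X j) hs).differentiable (by simp))
    simp only [hK]
    rw [h1, h2]
  have hop : opL G X A (cutBarrier G g X α η O) x = 1 / α * ∫ ξ in T \ O, ∑ i, ∑ j, A x i j *
      along G (X i) (along G (X j) fun x => K (x, ξ)) x := by
    rw [← sum_along_along_setIntegral G X (A x) hKs hTc hTO x, opL]
    simp only [Finset.mul_sum]
    refine Finset.sum_congr rfl fun i _ => Finset.sum_congr rfl fun j _ => ?_
    rw [along_along_congr hO hHs hd (X i) (X j) (hO' hx)]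
    ring
  have hdc : Continuous fun ξ => lowerDensity G g X α σ (G.mul (G.inv x) ξ) :=
    (continuous_lowerDensity hG hX hσ).comp (contDiff_mul_left G _ (k := 0)).continuous
  have hmono : ∫ ξ in T \ O, α * lam * lowerDensity G g X α σ (G.mul (G.inv x) ξ) ≤
      ∫ ξ in T \ O, ∑ i, ∑ j, A x i j * along G (X i) (along G (X j) fun x => K (x, ξ)) x := by
    refine setIntegral_mono_on
      (integrableOn_of_continuous_of_subset (continuous_const.mul hdc) hTc hTO)
      (integrableOn_sum_along_along G X (A x) hKs hTc hTO x)
      (hTc.measurableSet.diff hO.measurableSet) fun ξ hξ => ?_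
    -- If ξ were within gauge distance 2ε of `x`, the distance hypothesis would place it in `O`; so
    -- the truncated region is never integrated over.
    have hfar : (2 * ε) ^ 4 < gaugePow G g X (G.mul (G.inv ξ) x) := by
      by_contra h
      rw [not_lt, ← gaugePow_inv_mul_comm hG hX, gaugePow_eq_gaugeNorm_pow hG hX,
        pow_le_pow_iff_left₀ (gaugeNorm_nonneg hG hX _) (by positivity) (by norm_num)] at h
      have := mul_mem_of_lt_gaugeDist hG hX hO hO' hdist hx h
      rw [hcancel] at this
      exact hξ.2 this
    simp only [hcomp]
    have hsymm : lowerDensity G g X α σ (G.mul (G.inv x) ξ) =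
        lowerDensity G g X α σ (G.mul (G.inv ξ) x) := by
      rw [lowerDensity, lowerDensity, horSq_inv_mul_comm hG hX, gaugePow_inv_mul_comm hG hX]
    rw [hsymm]
    exact lowerDensity_le hG hX hα hαδ hδ hσ hε hη hA hL hfar
  -- No mass is lost: inside `O` one has N < σ, outside both `O` and `T` one has N > 2σ, and the
  -- density vanishes in either case.
  have hall : ∫ ξ in T \ O, lowerDensity G g X α σ (G.mul (G.inv x) ξ) =
      ∫ y, lowerDensity G g X α σ y := by
    rw [← integral_comp_mul_left G (G.inv x) (lowerDensity G g X α σ)]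
    refine setIntegral_eq_integral_of_forall_compl_eq_zero fun ξ hξ => ?_
    by_cases hξO : ξ ∈ O
    · exact lowerDensity_of_lt hσ (hσb x ξ (hsub (hO' hx)) (hsub hξO))
    · have hξT : ξ ∉ T := fun h => hξ ⟨h, hξO⟩
      exact lowerDensity_of_gt hσ ((le_max_left _ _).trans_lt (hT x (hO' hx) ξ hξT))
  rw [integral_const_mul, hall] at hmono
  rw [hop]
  calc (∫ y, lowerDensity G g X α σ y) * lam
      = 1 / α * (α * lam * ∫ y, lowerDensity G g X α σ y) := by field_simp
    _ ≤ _ := mul_le_mul_of_nonneg_left hmono (by positivity)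

end Main

end HType

end

theorem lemma3p1 {m n : ℕ} (hn : 0 < n)
    (G : HType.HomogeneousLieGroup m n) (g : LinearMap.BilinForm ℝ (HType.Pt m n))
    (hG : HType.IsHType G g)
    (X : Fin m → HType.Pt m n) (hX : HType.IsHorizontalBasis G g X)
    (δ α : ℝ) (hδ : 0 < δ) (hδ2 : δ ≤ 2) (hα : α = HType.homDim m n - δ) :
    ∃ C : ℝ, 0 < C ∧
      ∀ O : Set (HType.Pt m n), IsOpen O → O ⊆ HType.gaugeBall G g X 1 →
        (∀ x, IntegrableOn (HType.kernel G g X α x) O) ∧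
        (∀ ε : ℝ, 0 < ε → ∀ η : ℝ → ℝ, HType.IsCutoff ε η →
          (∀ x, IntegrableOn (HType.cutKernel G g X α η x) O) ∧
          ContDiff ℝ ∞ (HType.cutBarrier G g X α η O)) ∧
        (∀ η : ℝ → ℝ → ℝ, (∀ ε, 0 < ε → HType.IsCutoff ε (η ε)) →
          TendstoUniformly (fun ε => HType.cutBarrier G g X α (η ε) O)
            (HType.barrier G g X α O) (𝓝[>] 0)) ∧
        ∀ lam Lam : ℝ, 0 < lam → lam ≤ Lam →
          ∀ (Ω : Set (HType.Pt m n)) (A : HType.Pt m n → Matrix (Fin m) (Fin m) ℝ), IsOpen Ω →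
            (∀ x ∈ Ω, HType.IsElliptic lam Lam (A x)) → (∀ x ∈ Ω, HType.Landis n δ (A x)) →
            ∀ O' : Set (HType.Pt m n), IsCompact O' → O' ⊆ O → O' ⊆ Ω →
              ∀ ε : ℝ, 0 < ε → 2 * ε < HType.gaugeDist G g X O' (frontier O) →
                ∀ η : ℝ → ℝ, HType.IsCutoff ε η →
                  ∀ x ∈ O', C * lam ≤ HType.opL G X A (HType.cutBarrier G g X α η O) x := by
  have hm : 0 < m := hX.pos_dim hG hn
  -- Both layers are nontrivial, so Q ≥ 3, and δ ≤ 2 leaves α ≥ 1.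
  have hαpos : 0 < α := by
    have h1 : (1 : ℝ) ≤ m := by exact_mod_cast hm
    have h2 : (1 : ℝ) ≤ n := by exact_mod_cast hn
    rw [hα, HType.homDim]
    linarith
  have hαQ : α < HType.homDim m n := by linarith
  obtain ⟨σ, hσ, hσb⟩ := HType.exists_bound_gaugePow hG hX
  refine ⟨∫ y, HType.lowerDensity G g X α σ y, HType.integral_lowerDensity_pos hG hX hm hσ,
    fun O hO hOB => ?_⟩
  have hfin : volume O ≠ ⊤ := ((measure_mono (hOB.trans (HType.gaugeBall_subset hG hX))).trans_lt
    (HType.isCompact_gaugePow_le hG hX 1).measure_lt_top).ne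
  refine ⟨HType.integrableOn_kernel hG hX hαpos hαQ hfin, fun ε hε η hη =>
    ⟨HType.integrableOn_cutKernel hG hX hαpos hε hη hOB,
      HType.contDiff_cutBarrier hG hX hαpos hε hη hOB⟩, fun η hη => ?_, ?_⟩
  · exact HType.tendstoUniformly_cutBarrier hG hX hαpos hαQ hfin hη fun ε hε =>
      HType.integrableOn_cutKernel hG hX hαpos hε (hη ε hε) hOB
  · intro lam Lam _ _ Ω A _ hell hlan O' _ hO'O hO'Ω ε hε hdist η hη x hx
    exact HType.le_opL_cutBarrier hG hX hαpos hα hδ2 hσ hε hη hσb hO hOB hO'O hdist hx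
      (hell x (hO'Ω hx)) (hlan x (hO'Ω hx))
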